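/- Let $p\ge q\ge 2$ be integers, let $I=\{(i,j): 1\le i\le p,\ 1\le j\le q,\ j\le i\}$, and for $x\in\mathbb{R}^{I}$ and $S\subseteq I$ put $x(S)=\sum_{(i,j)\in S}x_{ij}$. Write $\langle\eta,j\rangle=(j+\eta-1,j)$ for the position in column $j$ on the $\eta$-th diagonal, and $\mathrm{row}_i=\{(i,1),\dots,(i,\min\{i,q\})\}$. The packing orbitope for the symmetric group $\mathfrak{S}_q$ is the convex hull of all $p\times q$ matrices with entries in $\{0,1\}$ that have at most one $1$-entry in every row and that are lexicographically maximal (reading the entries row by row) among all matrices obtained from them by permuting columns. All matrices in it have zero entries above the main diagonal (at positions $(i,j)$ with $i<j$), so it is regarded as a polytope $O_{p,q}\subset\mathbb{R}^{I}$. Theorem. $O_{p,q}$ is the set of all $x\in\mathbb{R}^{I}$ that satisfy the following constraints: 1. the row-sum inequalities $x(\mathrm{row}_i)\le 1$ for $1\le i\le p$; 2. the nonnegativity constraints $x_{ij}\ge 0$ for all $(i,j)\in I\setminus\{(j,j): j<q\}$; 3. the shifted column inequalities $x(B)-x(S)\le 0$ for all bars $B=\{(i,j),(i,j+1),\dots,(i,\min\{i,q\})\}$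 with $(i,j)=\langle\eta,j\rangle\in I$, $j\ge 2$, and all shifted columns $S=\{\langle 1,c_1\rangle,\langle 2,c_2\rangle,\dots,\langle\eta,c_\eta\rangle\}$ with integers $1\le c_1=c_2\le\dots\le c_\eta\le j-1$, where in the case $\eta=1$ the condition on $S$ is that $j=c_1+1$. The polytope $O_{p,q}$ is full-dimensional, that is, $\dim O_{p,q}=|I|$; each of these constraints defines a facet of $O_{p,q}$; and the system is non-redundant, that is, dropping any one of the constraints enlarges the set of solutions. Moreover, the separation problem for this system can be solved in time $O(pq)$ in the unit-cost model: there are a constant $C$ and a single random access machine program that, for all $p\ge q\ge 2$ and every $x\in\mathbb{Q}^{I}$, halts after at most $C\,pq$ elementary steps (additions, subtractions, comparisons and memory accesses, on rational numbers and on integers used for addressing) and either reports that $x$ satisfies all constraints or outputs a constraint of the system that $x$ violates. -/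

import Mathlib

/-! Rows and columns are numbered from `0`: the index set `{1, …, n}` is `Fin n`, and the diagonals
are numbered from `0` as well (the main diagonal is number `0`). -/

namespace Orbitope

noncomputable section

/-! ### Packing orbitopes -/

/-- `p × q` matrices with real entries. -/
abbrev Mat (p q : ℕ) := Matrix (Fin p) (Fin q) ℝ

/-- `A ≺ B`: at the first position, reading row by row, where `A` and `B` differ, the entry of `A`
is the smaller one. -/
def LexLT {p q : ℕ} (A B : Mat p q) : Prop :=
  ∃ k l, A k l < B k l ∧ ∀ i j, (i < k ∨ (i = k ∧ j < l)) → A i j = B i j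

/-- The 0/1-matrices with at most one `1` in every row. -/
def packingMatrices (p q : ℕ) : Set (Mat p q) :=
  {A | (∀ i j, A i j = 0 ∨ A i j = 1) ∧ ∀ i, ∑ j, A i j ≤ 1}

/-- The 0/1-matrices that are `≺`-maximal in their orbit under the group `G` of column
permutations. -/
def maximalMatrices (p q : ℕ) (G : Subgroup (Equiv.Perm (Fin q))) : Set (Mat p q) :=
  {A | (∀ i j, A i j = 0 ∨ A i j = 1) ∧ ∀ σ ∈ G, ¬ LexLT A (A.submatrix id σ)}

/-- The packing orbitope of the group `G`, as a set of `p × q` matrices. -/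
def packingOrbitope (p q : ℕ) (G : Subgroup (Equiv.Perm (Fin q))) : Set (Mat p q) :=
  convexHull ℝ (maximalMatrices p q G ∩ packingMatrices p q)

/-- The positions `(i, j)` of a `p × q` matrix with `j ≤ i`. -/
abbrev Tri (p q : ℕ) := {e : Fin p × Fin q // (e.2 : ℕ) ≤ (e.1 : ℕ)}

namespace Tri

/-- The row of a position. -/
def row {p q : ℕ} (e : Tri p q) : ℕ := e.1.1

/-- The column of a position. -/
def col {p q : ℕ} (e : Tri p q) : ℕ := e.1.2

end Tri

/-- Dropping the entries above the main diagonal. -/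
def dropUpper {p q : ℕ} (A : Mat p q) : Tri p q → ℝ := fun e => A e.1.1 e.1.2

/-- The packing orbitope of the full symmetric group, in the space of the entries on and below the
main diagonal. -/
def symPackingOrbitope (p q : ℕ) : Set (Tri p q → ℝ) :=
  dropUpper '' packingOrbitope p q ⊤

/-! ### Linear inequalities, dimension and facets -/

/-- The linear inequality `lhs x ≤ rhs`. -/
structure LinIneq (ι : Type) where
  lhs : (ι → ℝ) →ₗ[ℝ] ℝ
  rhs : ℝ

/-- The set of solutions of a system of linear inequalities. -/
def solutions {ι : Type} (sys : Set (LinIneq ι)) : Set (ι → ℝ) :=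
  {x | ∀ r ∈ sys, r.lhs x ≤ r.rhs}

/-- No inequality can be dropped without enlarging the set of solutions. -/
def NonRedundant {ι : Type} (sys : Set (LinIneq ι)) : Prop :=
  ∀ r ∈ sys, solutions sys ⊂ solutions (sys \ {r})

/-- The dimension of (the affine hull of) a nonempty set. -/
def polyDim {ι : Type} (P : Set (ι → ℝ)) : ℕ := Module.finrank ℝ (vectorSpan ℝ P)

/-- The inequality is valid for `P`, and its face is nonempty of dimension `dim P - 1`. -/
def DefinesFacet {ι : Type} (P : Set (ι → ℝ)) (r : LinIneq ι) : Prop :=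
  (∀ x ∈ P, r.lhs x ≤ r.rhs) ∧ (P ∩ {x | r.lhs x = r.rhs}).Nonempty ∧
    polyDim (P ∩ {x | r.lhs x = r.rhs}) + 1 = polyDim P

/-! ### The system of constraints -/

/-- The linear form `x(S) = ∑ e ∈ S, x e`. -/
def sumOver {p q : ℕ} (S : Finset (Tri p q)) : (Tri p q → ℝ) →ₗ[ℝ] ℝ :=
  ∑ e ∈ S, LinearMap.proj e

/-- The positions in row `i`. -/
def rowSet (p q i : ℕ) : Finset (Tri p q) := {e | e.row = i}

/-- The bar with leader `(i, j)`: the positions in row `i` from column `j` on. -/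
def bar (p q i j : ℕ) : Finset (Tri p q) := {e | e.row = i ∧ j ≤ e.col}

/-- The positions `(c k + k, c k)` for `k < η`: one in each of the first `η` diagonals, the one
in diagonal `k` lying in column `c k`. -/
def shiftedColumn (p q η : ℕ) (c : ℕ → ℕ) : Finset (Tri p q) :=
  {e | ∃ k < η, e.row = c k + k ∧ e.col = c k}

/-- `x(row i) ≤ 1`. -/
def rowIneq (p q i : ℕ) : LinIneq (Tri p q) := ⟨sumOver (rowSet p q i), 1⟩

/-- `x (i, j) ≥ 0`, written as `- x (i, j) ≤ 0`. -/
def nonnegIneq (p q i j : ℕ) : LinIneq (Tri p q) :=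
  ⟨-sumOver {e | e.row = i ∧ e.col = j}, 0⟩

/-- `x(B) - x(S) ≤ 0`, where `B` is the bar with leader `(i, j)`, and `S` is the shifted column in
the columns `c 0, c 1, …, c (i - j)`. -/
def shiftedColumnIneq (p q i j : ℕ) (c : ℕ → ℕ) : LinIneq (Tri p q) :=
  ⟨sumOver (bar p q i j) - sumOver (shiftedColumn p q (i - j + 1) c), 0⟩

/-- The leader `(i, j)` lies on or below the main diagonal and `c 0 = c 1 ≤ … ≤ c (i - j) < j`;
if `(i, j)` is on the main diagonal (only `c 0` matters then), `j = c 0 + 1`. -/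
def IsReducedShift (p q i j : ℕ) (c : ℕ → ℕ) : Prop :=
  i < p ∧ j < q ∧ 1 ≤ j ∧ j ≤ i ∧
    (∀ k l, k ≤ l → l ≤ i - j → c k ≤ c l) ∧ c (i - j) < j ∧
    (j < i → c 0 = c 1) ∧ (i = j → j = c 0 + 1)

/-- The system of all constraints: row-sum inequalities, nonnegativity constraints except at the
positions `(j, j)` outside the last column, and shifted column inequalities. -/
def packingSystem (p q : ℕ) : Set (LinIneq (Tri p q)) :=
  {r | ∃ i < p, r = rowIneq p q i} ∪
  {r | ∃ i j, i < p ∧ j < q ∧ j ≤ i ∧ ¬ (i = j ∧ j + 1 < q) ∧ r = nonnegIneq p q i j} ∪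
  {r | ∃ i j c, IsReducedShift p q i j c ∧ r = shiftedColumnIneq p q i j c}

/-! ### Random access machines with unit costs

A machine has integer registers, rational registers, and arrays of integers and of rationals of
unbounded length. It adds, subtracts and compares numbers, and reads and writes array cells whose
address stands in an integer register. The registers and arrays that an instruction refers to are
fixed in the program; so every program uses only finitely many registers and arrays. -/

/-- The memory of a machine. -/
structure State where
  /-- integer registers -/
  reg : ℕ → ℕ
  /-- rational registers -/
  acc : ℕ → ℚ
  /-- arrays of integers: `natArr k a` is cell `a` of array `k` -/
  natArr : ℕ → ℕ → ℕ
  /-- arrays of rationals: `ratArr k a` is cell `a` of array `k` -/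
  ratArr : ℕ → ℕ → ℚ

/-- The elementary instructions; `d` is the target, `a` and `b` are the operands. -/
inductive Instr where
  | nop
  | natConst (d n : ℕ)
  | natAdd (d a b : ℕ)
  | natSub (d a b : ℕ)
  | natLoad (d k a : ℕ)
  | natStore (k a b : ℕ)
  | ratConst (d : ℕ) (r : ℚ)
  | ratAdd (d a b : ℕ)
  | ratSub (d a b : ℕ)
  | ratLoad (d k a : ℕ)
  | ratStore (k a b : ℕ)

/-- The effect of an instruction. -/
def Instr.run : Instr → State → State
  | nop, s => s
  | natConst d n, s => { s with reg := Function.update s.reg d n }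
  | natAdd d a b, s => { s with reg := Function.update s.reg d (s.reg a + s.reg b) }
  | natSub d a b, s => { s with reg := Function.update s.reg d (s.reg a - s.reg b) }
  | natLoad d k a, s => { s with reg := Function.update s.reg d (s.natArr k (s.reg a)) }
  | natStore k a b, s =>
    { s with natArr :=
        Function.update s.natArr k (Function.update (s.natArr k) (s.reg a) (s.reg b)) }
  | ratConst d r, s => { s with acc := Function.update s.acc d r }
  | ratAdd d a b, s => { s with acc := Function.update s.acc d (s.acc a + s.acc b) }
  | ratSub d a b, s => { s with acc := Function.update s.acc d (s.acc a - s.acc b) }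
  | ratLoad d k a, s => { s with acc := Function.update s.acc d (s.ratArr k (s.reg a)) }
  | ratStore k a b, s =>
    { s with ratArr :=
        Function.update s.ratArr k (Function.update (s.ratArr k) (s.reg a) (s.acc b)) }

/-- The elementary tests: comparison of two registers. -/
inductive Test where
  | natLT (a b : ℕ)
  | ratLT (a b : ℕ)

/-- The test succeeds. -/
def Test.Holds : Test → State → Prop
  | natLT a b, s => s.reg a < s.reg b
  | ratLT a b, s => s.acc a < s.acc b

/-- Programs. -/
inductive Prog where
  | instr (c : Instr)
  | seq (P Q : Prog)
  | ite (b : Test) (P Q : Prog)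
  | while (b : Test) (P : Prog)

/-- `Exec P s s' t`: started in `s`, the program `P` halts in `s'` after exactly `t` steps. Every
instruction and every evaluation of a test is one step. -/
inductive Exec : Prog → State → State → ℕ → Prop where
  | instr (c : Instr) (s : State) : Exec (.instr c) s (c.run s) 1
  | seq {P Q : Prog} {s s₁ s₂ : State} {t₁ t₂ : ℕ} :
      Exec P s s₁ t₁ → Exec Q s₁ s₂ t₂ → Exec (.seq P Q) s s₂ (t₁ + t₂)
  | ite_true {b : Test} {P Q : Prog} {s s' : State} {t : ℕ} :
      b.Holds s → Exec P s s' t → Exec (.ite b P Q) s s' (t + 1)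
  | ite_false {b : Test} {P Q : Prog} {s s' : State} {t : ℕ} :
      ¬ b.Holds s → Exec Q s s' t → Exec (.ite b P Q) s s' (t + 1)
  | while_true {b : Test} {P : Prog} {s s₁ s₂ : State} {t₁ t₂ : ℕ} :
      b.Holds s → Exec P s s₁ t₁ → Exec (.while b P) s₁ s₂ t₂ →
      Exec (.while b P) s s₂ (t₁ + t₂ + 1)
  | while_false {b : Test} {P : Prog} {s : State} :
      ¬ b.Holds s → Exec (.while b P) s s 1

/-! ### The separation problem -/

/-- The initial memory: `p` and `q` are in the integer registers `0` and `1`, the entry `x (i, j)`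
is in cell `i * q + j` of the rational array `0`, and everything else is `0`. -/
def inputState {p q : ℕ} (x : Tri p q → ℚ) : State where
  reg := fun k => if k = 0 then p else if k = 1 then q else 0
  acc := fun _ => 0
  natArr := fun _ _ => 0
  ratArr := fun k a => if k = 0 then ∑ e : Tri p q, if e.row * q + e.col = a then x e else 0 else 0

/-- The answer that the final memory encodes: `none` (all constraints hold) or an inequality. The
integer register `0` holds the kind of the answer, the registers `1` and `2` hold the row, or the
position `(i, j)`, that the inequality belongs to, and the integer array `0` holds the columns
`c 0, c 1, …` of a shifted column. -/
def answer (p q : ℕ) (s : State) : Option (LinIneq (Tri p q)) :=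
  match s.reg 0 with
  | 0 => none
  | 1 => some (rowIneq p q (s.reg 1))
  | 2 => some (nonnegIneq p q (s.reg 1) (s.reg 2))
  | _ => some (shiftedColumnIneq p q (s.reg 1) (s.reg 2) (s.natArr 0))

/-- A correct answer to the separation problem for the point `x`: `none` if `x` satisfies the whole
system, and otherwise an inequality of the system that `x` violates. -/
def IsCorrectAnswer {p q : ℕ} (x : Tri p q → ℝ) : Option (LinIneq (Tri p q)) → Prop
  | none => x ∈ solutions (packingSystem p q)
  | some r => r ∈ packingSystem p q ∧ r.rhs < r.lhs x

end

end Orbitope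

/-!
The columns of a matrix with at most one `1` per row can be sorted so that each column is entered
after the one to its left. Hence the vertices of the packing orbitope are the indicator matrices
of *ladders* (`IsLadder`, `maximal_inter_packing`): sets of positions with at most one position
per row in which every occupied column but the first has its left neighbour occupied in an earlier
row.

Validity of the shifted column inequalities follows by a walk (`IsLadder.meets`): a ladder that
has entered column `j` by row `i` meets every shifted column that ends on the diagonal of `(i, j)`
and stays in the columns up to `j`.

For the converse, let `lightest X i j` be the least weight of such a shifted column; it satisfies
the recursion of a shortest path problem. A solution `X` of the system satisfies `Checks`: the row
sums are at most `1`, the entries are nonnegative, and the bar with leader `(i + 1, j + 1)` weighs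
at most `lightest X i j`. From this a random ladder with expectation `X` is built row by row. The
number of columns that it has entered is distributed so that `min 1 (lightest X i j)` is the
probability that column `j` has been entered by row `i` (`reach`). The difference of these
probabilities in two consecutive rows is the probability that the row enters a new column. The
rest of the row must be put into columns that have been entered already, and the inequalities for
the bars are exactly the condition of stochastic dominance under which a monotone transport plan
does this (`exists_plan`, `convexHull_step`).

Facets are recognized by exhibiting enough directions of the face (`definesFacet_of_single_mem`),
each of them a difference of two ladders; the main case is `single_mem_of_off`. Distinct
inequalities with coefficients `-1`, `0`, `1` define distinct facets, and so none of them is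
redundant (`nonRedundant_of_facets`).

The separation program fills the table of `lightest` row by row, checks the three kinds of
constraints at each position, and keeps the last violation that it finds. If it finds none, then
`Checks` holds, and the point lies in the orbitope. If a bar is too heavy, a lightest shifted
column is traced back through the table (`Trace`), and this shifted column has the form that the
system requires.
-/

namespace Orbitope

open Finset

/-! ### Entries and sums over sets of positions -/

/-- The entry at `(i, j)`, with the value `0` at pairs that are not positions. Going through all of
`ℕ × ℕ` keeps bounds out of the formulas. -/
def entry {α : Type*} [Zero α] {p q : ℕ} (x : Tri p q → α) (i j : ℕ) : α :=
  if h : i < p ∧ j < q ∧ j ≤ i then x ⟨(⟨i, h.1⟩, ⟨j, h.2.1⟩), h.2.2⟩ else 0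

theorem entry_of_not {α : Type*} [Zero α] {p q : ℕ} (x : Tri p q → α) {i j : ℕ}
    (h : ¬ (i < p ∧ j < q ∧ j ≤ i)) : entry x i j = 0 := dif_neg h

theorem Tri.row_lt {p q : ℕ} (e : Tri p q) : e.row < p := e.1.1.2

theorem Tri.col_lt {p q : ℕ} (e : Tri p q) : e.col < q := e.1.2.2

theorem Tri.col_le_row {p q : ℕ} (e : Tri p q) : e.col ≤ e.row := e.2

theorem Tri.eq_of_row_of_col {p q : ℕ} {e f : Tri p q} (h₁ : e.row = f.row)
    (h₂ : e.col = f.col) : e = f :=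
  Subtype.ext (Prod.ext (Fin.ext h₁) (Fin.ext h₂))

theorem Tri.exists_of_le {p q i j : ℕ} (hi : i < p) (hj : j < q) (h : j ≤ i) :
    ∃ e : Tri p q, e.row = i ∧ e.col = j :=
  ⟨⟨(⟨i, hi⟩, ⟨j, hj⟩), h⟩, rfl, rfl⟩

theorem entry_row_col {α : Type*} [Zero α] {p q : ℕ} (x : Tri p q → α) (e : Tri p q) :
    entry x e.row e.col = x e :=
  dif_pos ⟨e.row_lt, e.col_lt, e.col_le_row⟩

theorem entry_cast {p q : ℕ} (x : Tri p q → ℚ) (i j : ℕ) :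
    entry (fun e => (x e : ℝ)) i j = ((entry x i j : ℚ) : ℝ) := by
  unfold entry
  split_ifs <;> simp

theorem entry_eq_sum {α : Type*} [AddCommMonoid α] {p q : ℕ} (x : Tri p q → α) (i j : ℕ) :
    entry x i j = ∑ e : Tri p q, if e.row = i ∧ e.col = j then x e else 0 := by
  by_cases h : i < p ∧ j < q ∧ j ≤ i
  · obtain ⟨e, rfl, rfl⟩ := Tri.exists_of_le h.1 h.2.1 h.2.2
    rw [entry_row_col, Finset.sum_eq_single e]
    · simp
    · intro f _ hf
      rw [if_neg]
      exact fun h => hf (Tri.eq_of_row_of_col h.1 h.2)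
    · simp
  · rw [entry_of_not x h, Finset.sum_eq_zero]
    intro e _
    rw [if_neg]
    rintro ⟨rfl, rfl⟩
    exact h ⟨e.row_lt, e.col_lt, e.col_le_row⟩

theorem sumOver_apply {p q : ℕ} (S : Finset (Tri p q)) (x : Tri p q → ℝ) :
    sumOver S x = ∑ e ∈ S, x e := by
  simp [sumOver, LinearMap.sum_apply]

theorem sumOver_bar {p q : ℕ} (x : Tri p q → ℝ) (i j : ℕ) :
    sumOver (bar p q i j) x = ∑ k ∈ Ico j q, entry x i k := by
  simp only [entry_eq_sum]
  rw [Finset.sum_comm, sumOver_apply, bar, Finset.sum_filter]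
  refine Finset.sum_congr rfl fun e _ => ?_
  by_cases h : e.row = i ∧ j ≤ e.col
  · rw [if_pos h, Finset.sum_eq_single e.col]
    · simp [h.1]
    · intro k _ hk
      rw [if_neg]
      exact fun h' => hk h'.2.symm
    · intro hk
      exact absurd (Finset.mem_Ico.2 ⟨h.2, e.col_lt⟩) hk
  · rw [if_neg h, Finset.sum_eq_zero]
    intro k hk
    rw [if_neg]
    rintro ⟨h₁, rfl⟩
    exact h ⟨h₁, (Finset.mem_Ico.1 hk).1⟩

theorem sumOver_rowSet {p q : ℕ} (x : Tri p q → ℝ) (i : ℕ) :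
    sumOver (rowSet p q i) x = ∑ k ∈ range q, entry x i k := by
  have : rowSet p q i = bar p q i 0 := by ext; simp [rowSet, bar]
  rw [this, sumOver_bar, Finset.range_eq_Ico]

theorem sumOver_position {p q : ℕ} (x : Tri p q → ℝ) (i j : ℕ) :
    sumOver {e : Tri p q | e.row = i ∧ e.col = j} x = entry x i j := by
  rw [entry_eq_sum, sumOver_apply, Finset.sum_filter]

theorem sumOver_shiftedColumn {p q : ℕ} (x : Tri p q → ℝ) (n : ℕ) (c : ℕ → ℕ) :
    sumOver (shiftedColumn p q n c) x = ∑ k ∈ range n, entry x (c k + k) (c k) := by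
  simp only [entry_eq_sum]
  rw [Finset.sum_comm, sumOver_apply, shiftedColumn, Finset.sum_filter]
  refine Finset.sum_congr rfl fun e _ => ?_
  split_ifs with h
  · obtain ⟨k, hk, h₁, h₂⟩ := h
    rw [Finset.sum_eq_single k]
    · simp [h₁, h₂]
    · intro l _ hl
      rw [if_neg]
      rintro ⟨h₃, h₄⟩
      omega
    · intro h
      exact absurd (Finset.mem_range.2 hk) h
  · symm
    refine Finset.sum_eq_zero fun k hk => if_neg fun h' => h ⟨k, Finset.mem_range.1 hk, h'⟩

/-! ### Ladders -/

/-- A set of positions with at most one position in every row, such that every column but the first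
is entered only after the column to its left. The packing orbitope is spanned by the indicator
matrices of these sets. -/
structure IsLadder (F : ℕ → ℕ → Prop) : Prop where
  row : ∀ {i j k}, F i j → F i k → j = k
  start : ∀ {i j}, F i (j + 1) → ∃ i' < i, F i' j

theorem IsLadder.le {F : ℕ → ℕ → Prop} (hF : IsLadder F) {i j : ℕ} (h : F i j) : j ≤ i := by
  induction j generalizing i with
  | zero => exact Nat.zero_le _
  | succ j ih =>
    obtain ⟨i', hi', h'⟩ := hF.start h
    have := ih h'
    omega

/-- Every column to the left of an occupied position has been entered in an earlier row. -/
theorem IsLadder.exists_of_lt {F : ℕ → ℕ → Prop} (hF : IsLadder F) {i j k : ℕ} (h : F i j)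
    (hk : k < j) : ∃ i' < i, F i' k := by
  induction j generalizing i with
  | zero => omega
  | succ j ih =>
    obtain ⟨i', hi', h'⟩ := hF.start h
    rcases Nat.lt_succ_iff_lt_or_eq.1 hk with hk | rfl
    · obtain ⟨i'', h₁, h₂⟩ := ih h' hk
      exact ⟨i'', h₁.trans hi', h₂⟩
    · exact ⟨i', hi', h'⟩

theorem isLadder_empty : IsLadder fun _ _ => False := ⟨fun h => h.elim, fun h => h.elim⟩

theorem IsLadder.insert {F : ℕ → ℕ → Prop} (hF : IsLadder F) {i j : ℕ} (hi : ∀ k, ¬ F i k)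
    (hj : ∀ k, j = k + 1 → ∃ i' < i, F i' k) :
    IsLadder fun a b => F a b ∨ (a = i ∧ b = j) where
  row := by
    rintro a b c (h₁ | ⟨rfl, rfl⟩) (h₂ | ⟨h₂, rfl⟩)
    · exact hF.row h₁ h₂
    · subst h₂; exact (hi _ h₁).elim
    · exact (hi _ h₂).elim
    · rfl
  start := by
    rintro a b (h | ⟨rfl, rfl⟩)
    · obtain ⟨i', h₁, h₂⟩ := hF.start h
      exact ⟨i', h₁, Or.inl h₂⟩
    · obtain ⟨i', h₁, h₂⟩ := hj b rfl
      exact ⟨i', h₁, Or.inl h₂⟩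

open Classical in
/-- The indicator matrix of a set of positions. -/
noncomputable def ind (F : ℕ → ℕ → Prop) : ℕ → ℕ → ℝ := fun i j => if F i j then 1 else 0

theorem ind_of {F : ℕ → ℕ → Prop} {i j : ℕ} (h : F i j) : ind F i j = 1 := if_pos h

theorem ind_of_not {F : ℕ → ℕ → Prop} {i j : ℕ} (h : ¬ F i j) : ind F i j = 0 := if_neg h

theorem ind_insert {F : ℕ → ℕ → Prop} {i j : ℕ} (h : ¬ F i j) :
    ind (fun a b => F a b ∨ (a = i ∧ b = j)) = ind F + ind fun a b => a = i ∧ b = j := by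
  funext a b
  simp only [Pi.add_apply]
  by_cases hab : a = i ∧ b = j
  · rw [ind_of (Or.inr hab), ind_of (F := fun a b => a = i ∧ b = j) hab]
    obtain ⟨rfl, rfl⟩ := hab
    rw [ind_of_not h, zero_add]
  · rw [ind_of_not (F := fun a b => a = i ∧ b = j) hab, add_zero]
    by_cases hF : F a b
    · rw [ind_of hF, ind_of (Or.inl hF)]
    · rw [ind_of_not hF, ind_of_not (by tauto)]

/-- The upper left `p × q` corner of an infinite matrix. -/
def corner (p q : ℕ) : (ℕ → ℕ → ℝ) →ₗ[ℝ] Mat p q where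
  toFun M := Matrix.of fun i j => M i j
  map_add' _ _ := rfl
  map_smul' _ _ := rfl

@[simp] theorem corner_apply {p q : ℕ} (M : ℕ → ℕ → ℝ) (i : Fin p) (j : Fin q) :
    corner p q M i j = M i j := rfl

/-- The indicator vector of a set of positions. -/
noncomputable def vert (p q : ℕ) (F : ℕ → ℕ → Prop) : Tri p q → ℝ := fun e => ind F e.row e.col

theorem IsLadder.corner_mem {F : ℕ → ℕ → Prop} (hF : IsLadder F) (p q : ℕ) :
    corner p q (ind F) ∈ maximalMatrices p q ⊤ ∩ packingMatrices p q := by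
  have h01 : ∀ i j, ind F i j = 0 ∨ ind F i j = 1 := fun i j => by
    by_cases h : F i j
    · exact Or.inr (ind_of h)
    · exact Or.inl (ind_of_not h)
  have hone : ∀ {i j}, ind F i j = 1 → F i j := fun {i j} h => by
    by_contra h'
    rw [ind_of_not h'] at h
    exact zero_ne_one h
  refine ⟨⟨fun i j => h01 i j, ?_⟩, fun i j => h01 i j, fun i => ?_⟩
  · rintro σ - ⟨k, l, hlt, heq⟩
    simp only [Matrix.submatrix_apply, id, corner_apply] at hlt heq
    have h1 : F k (σ l) := by
      rcases h01 k (σ l) with h | h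
      · rcases h01 k l with h' | h' <;> rw [h, h'] at hlt <;> norm_num at hlt
      · exact hone h
    have hne : σ l ≠ l := fun h => by rw [h] at hlt; exact lt_irrefl _ hlt
    rcases lt_or_gt_of_ne hne with h | h
    · have h2 := heq k (σ l) (Or.inr ⟨rfl, h⟩)
      rw [ind_of h1] at h2
      exact hne (σ.injective (Fin.ext (hF.row h1 (hone h2.symm)).symm))
    · obtain ⟨i', hi', h2⟩ := hF.exists_of_lt h1 (Fin.lt_def.1 h)
      have h3 := heq ⟨i', hi'.trans k.2⟩ l (Or.inl hi')
      simp only at h3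
      rw [ind_of h2] at h3
      exact hne (Fin.ext (hF.row h2 (hone h3.symm)).symm)
  · by_cases h : ∃ j : Fin q, F i j
    · obtain ⟨j, hj⟩ := h
      rw [Finset.sum_eq_single j]
      · rw [corner_apply, ind_of hj]
      · intro k _ hk
        rw [corner_apply, ind_of_not]
        exact fun h => hk (Fin.ext (hF.row h hj))
      · simp
    · push Not at h
      rw [Finset.sum_eq_zero fun j _ => ?_]
      · exact zero_le_one
      · rw [corner_apply, ind_of_not (h j)]

theorem exists_isLadder_of_mem {p q : ℕ} {A : Mat p q}
    (hA : A ∈ maximalMatrices p q ⊤ ∩ packingMatrices p q) :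
    ∃ F, IsLadder F ∧ A = corner p q (ind F) := by
  obtain ⟨⟨h01, hmax⟩, -, hrow⟩ := hA
  have hnn : ∀ i j, 0 ≤ A i j := fun i j => by
    rcases h01 i j with h | h <;> rw [h]
    exact zero_le_one
  have huniq : ∀ {i j k}, A i j = 1 → A i k = 1 → j = k := fun {i j k} hj hk => by
    by_contra hne
    have h1 : ∑ l ∈ ({j, k} : Finset (Fin q)), A i l ≤ ∑ l, A i l :=
      Finset.sum_le_sum_of_subset_of_nonneg (Finset.subset_univ _) fun l _ _ => hnn i l
    rw [Finset.sum_pair hne, hj, hk] at h1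
    linarith [hrow i]
  refine ⟨fun i j => ∃ (hi : i < p) (hj : j < q), A ⟨i, hi⟩ ⟨j, hj⟩ = 1, ⟨?_, ?_⟩, ?_⟩
  · rintro i j k ⟨hi, hj, h⟩ ⟨_, hk, h'⟩
    simpa using huniq h h'
  · rintro i j ⟨hi, hj, h⟩
    by_contra hcon
    push Not at hcon
    have hj' : j < q := by omega
    have hz : ∀ a : Fin p, (a : ℕ) < i → A a ⟨j, hj'⟩ = 0 := fun a ha =>
      (h01 a _).resolve_right (hcon a ha a.2 hj')
    -- the first row in which the columns `j` and `j + 1` differ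
    have hex : ∃ n, ∃ hn : n < p, A ⟨n, hn⟩ ⟨j, hj'⟩ ≠ A ⟨n, hn⟩ ⟨j + 1, hj⟩ := by
      refine ⟨i, hi, fun he => ?_⟩
      rw [h] at he
      have := huniq he h
      simp at this
    classical
    obtain ⟨hn, hdiff⟩ := Nat.find_spec hex
    have hmin := fun m => Nat.find_min hex (m := m)
    have hle : Nat.find hex ≤ i := Nat.find_min' hex (by
      refine ⟨hi, fun he => ?_⟩
      rw [h] at he
      have := huniq he h
      simp at this)
    set n := Nat.find hex
    have hn0 : A ⟨n, hn⟩ ⟨j, hj'⟩ = 0 := by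
      rcases hle.lt_or_eq with h' | h'
      · exact hz _ h'
      · refine (h01 _ _).resolve_right fun he => ?_
        have h2 : A ⟨n, hn⟩ ⟨j + 1, hj⟩ = 1 := by simpa [h'] using h
        have := huniq he h2
        simp at this
    have hn1 : A ⟨n, hn⟩ ⟨j + 1, hj⟩ = 1 :=
      (h01 _ _).resolve_left fun he => hdiff (hn0.trans he.symm)
    refine hmax (Equiv.swap ⟨j, hj'⟩ ⟨j + 1, hj⟩) (Subgroup.mem_top _)
      ⟨⟨n, hn⟩, ⟨j, hj'⟩, ?_, ?_⟩
    · rw [Matrix.submatrix_apply, Equiv.swap_apply_left, id, hn0, hn1]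
      exact zero_lt_one
    · rintro a b (hab | ⟨rfl, hb⟩)
      · rw [Matrix.submatrix_apply, id]
        have he : A a ⟨j, hj'⟩ = A a ⟨j + 1, hj⟩ := by
          by_contra hne
          exact hmin a hab ⟨a.2, hne⟩
        rcases eq_or_ne b ⟨j, hj'⟩ with rfl | hb1
        · rw [Equiv.swap_apply_left, he]
        · rcases eq_or_ne b ⟨j + 1, hj⟩ with rfl | hb2
          · rw [Equiv.swap_apply_right, he]
          · rw [Equiv.swap_apply_of_ne_of_ne hb1 hb2]
      · rw [Matrix.submatrix_apply, Equiv.swap_apply_of_ne_of_ne]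
        · rfl
        · exact hb.ne
        · intro h'
          subst h'
          have := Fin.lt_def.1 hb
          simp at this
  · ext i j
    rw [corner_apply]
    rcases h01 i j with h | h
    · rw [ind_of_not, h]
      rintro ⟨_, _, h'⟩
      rw [show A ⟨i, _⟩ ⟨j, _⟩ = A i j from rfl, h] at h'
      exact zero_ne_one h'
    · rw [ind_of ⟨i.2, j.2, h⟩, h]

theorem maximal_inter_packing (p q : ℕ) :
    maximalMatrices p q ⊤ ∩ packingMatrices p q =
      (fun F => corner p q (ind F)) '' {F | IsLadder F} := by
  ext A
  constructor
  · intro hA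
    obtain ⟨F, hF, rfl⟩ := exists_isLadder_of_mem hA
    exact ⟨F, hF, rfl⟩
  · rintro ⟨F, hF, rfl⟩
    exact hF.corner_mem p q

theorem packingOrbitope_upper {p q : ℕ} {A : Mat p q} (hA : A ∈ packingOrbitope p q ⊤)
    {i : Fin p} {j : Fin q} (hij : (i : ℕ) < j) : A i j = 0 := by
  have hconv : Convex ℝ {A : Mat p q | A i j = 0} := by
    intro A hA B hB a b _ _ _
    simp only [Set.mem_ofPred_eq] at hA hB ⊢
    simp [hA, hB]
  refine convexHull_min ?_ hconv hA
  rw [maximal_inter_packing]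
  rintro _ ⟨F, hF, rfl⟩
  exact ind_of_not fun h => absurd (hF.le h) (by omega)

/-- `dropUpper` as a linear map. -/
def dropUpperₗ (p q : ℕ) : Mat p q →ₗ[ℝ] Tri p q → ℝ where
  toFun := dropUpper
  map_add' _ _ := rfl
  map_smul' _ _ := rfl

theorem symPackingOrbitope_eq (p q : ℕ) :
    symPackingOrbitope p q = convexHull ℝ (vert p q '' {F | IsLadder F}) := by
  rw [symPackingOrbitope, packingOrbitope, maximal_inter_packing]
  change (dropUpperₗ p q) '' _ = _
  rw [LinearMap.image_convexHull, Set.image_image]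
  rfl

theorem IsLadder.vert_mem {F : ℕ → ℕ → Prop} (hF : IsLadder F) (p q : ℕ) :
    vert p q F ∈ symPackingOrbitope p q := by
  rw [symPackingOrbitope_eq]
  exact subset_convexHull _ _ ⟨F, hF, rfl⟩


/-! ### The recursion for lightest shifted columns -/

/-- The least weight of a shifted column that ends on the diagonal of `(m, k)`, stays in the
columns up to `k`, and (if it has two elements at least) starts with two elements in one column;
the elements on the main diagonal are assumed to be ordered so that the last one is the lightest.
Pairs above the diagonal get the entry itself, which is `0` for `X = entry x`. -/
def lightest {α : Type*} [Add α] [Min α] (X : ℕ → ℕ → α) : ℕ → ℕ → α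
  | 0, k => X 0 k
  | m + 1, 0 => lightest X m 0 + X (m + 1) 0
  | m + 1, k + 1 =>
    if k < m then min (lightest X m (k + 1) + X (m + 1) (k + 1)) (lightest X m k)
    else X (m + 1) (k + 1)

theorem lightest_of_le {α : Type*} [Add α] [Min α] (X : ℕ → ℕ → α) {m k : ℕ} (h : m ≤ k) :
    lightest X m k = X m k := by
  rcases m with _ | m
  · rfl
  · obtain ⟨k, rfl⟩ : ∃ k', k = k' + 1 := ⟨k - 1, by omega⟩
    rw [lightest, if_neg (by omega)]

theorem lightest_diag {α : Type*} [Add α] [Min α] (X : ℕ → ℕ → α) (k : ℕ) :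
    lightest X k k = X k k :=
  lightest_of_le X le_rfl

theorem lightest_eq_min {α : Type*} [Add α] [Min α] (X : ℕ → ℕ → α) {i j : ℕ} (h1 : 1 ≤ j)
    (hji : j < i) :
    lightest X i j = min (lightest X (i - 1) j + X i j) (lightest X (i - 1) (j - 1)) := by
  obtain ⟨j, rfl⟩ : ∃ j', j = j' + 1 := ⟨j - 1, by omega⟩
  obtain ⟨i, rfl⟩ : ∃ i', i = i' + 1 := ⟨i - 1, by omega⟩
  rw [lightest, if_pos (by omega)]
  rfl

theorem lightest_zero {α : Type*} [Add α] [Min α] (X : ℕ → ℕ → α) {i : ℕ} (hi : 0 < i) :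
    lightest X i 0 = lightest X (i - 1) 0 + X i 0 := by
  obtain ⟨i, rfl⟩ : ∃ i', i = i' + 1 := ⟨i - 1, by omega⟩
  rfl

theorem lightest_cast (X : ℕ → ℕ → ℚ) (m k : ℕ) :
    lightest (fun i j => (X i j : ℝ)) m k = ((lightest X m k : ℚ) : ℝ) := by
  induction m generalizing k with
  | zero => rfl
  | succ m ih =>
    rcases k with _ | k
    · simp [lightest, ih]
    · simp only [lightest, ih]
      split_ifs <;> simp

/-- `c 0, …, c d` are the columns of a shifted column that starts with two elements in one column
if `d` is positive. -/
structure IsStart (c : ℕ → ℕ) (d k : ℕ) : Prop where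
  mono : ∀ a b, a ≤ b → b ≤ d → c a ≤ c b
  last : c d ≤ k
  two : 0 < d → c 0 = c 1
  one : d = 0 → c 0 = k

/-- A lightest shifted column for `(K + D, K)` is traced back from its end: its elements on the
diagonals above `d` are known to be in the columns `c (d + 1), …, c D`, and the others form a
lightest shifted column for `(k + d, k)`. -/
structure Trace {α : Type*} [AddCommMonoid α] [Min α] (X : ℕ → ℕ → α) (K D : ℕ) (c : ℕ → ℕ)
    (k d : ℕ) : Prop where
  weight : lightest X (K + D) K =
    lightest X (k + d) k + ∑ t ∈ Ico (d + 1) (D + 1), X (c t + t) (c t)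
  le_col : k ≤ K
  le_diag : d ≤ D
  mono : ∀ a b, d < a → a ≤ b → b ≤ D → c a ≤ c b
  lower : ∀ a, d < a → a ≤ D → k ≤ c a
  upper : ∀ a, d < a → a ≤ D → c a ≤ K
  main : d = 0 → (D = 0 ∧ k = K) ∨ (0 < D ∧ c 1 = k)

namespace Trace

variable {α : Type*} [AddCommMonoid α] [Min α] {X : ℕ → ℕ → α} {K D : ℕ} {c : ℕ → ℕ} {k d : ℕ}

theorem start (X : ℕ → ℕ → α) (K D : ℕ) (c : ℕ → ℕ) : Trace X K D c K D where
  weight := by rw [Finset.Ico_self, Finset.sum_empty, add_zero]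
  le_col := le_rfl
  le_diag := le_rfl
  mono a b ha hab hb := by omega
  lower a ha hb := by omega
  upper a ha hb := by omega
  main h := Or.inl ⟨h, rfl⟩

/-- The element in column `k` is taken. -/
theorem take (h : Trace X K D c k (d + 1))
    (he : lightest X (k + (d + 1)) k = lightest X (k + d) k + X (k + (d + 1)) k) :
    Trace X K D (Function.update c (d + 1) k) k d where
  weight := by
    have hd := h.le_diag
    rw [h.weight, he, Finset.sum_eq_sum_Ico_succ_bot (show d + 1 < D + 1 by omega),
      Function.update_self, add_assoc]
    congr 2
    refine Finset.sum_congr rfl fun t ht => ?_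
    rw [Function.update_of_ne (by have := (Finset.mem_Ico.1 ht).1; omega)]
  le_col := h.le_col
  le_diag := (Nat.le_succ d).trans h.le_diag
  mono a b ha hab hb := by
    rcases (Nat.succ_le_of_lt ha).lt_or_eq with ha | rfl
    · rw [Function.update_of_ne (by omega), Function.update_of_ne (by omega)]
      exact h.mono a b ha hab hb
    · rw [Function.update_self]
      rcases hab.lt_or_eq with hb' | rfl
      · rw [Function.update_of_ne (by omega)]
        exact h.lower b hb' hb
      · rw [Function.update_self]
  lower a ha hb := by
    rcases (Nat.succ_le_of_lt ha).lt_or_eq with ha | rfl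
    · rw [Function.update_of_ne (by omega)]
      exact h.lower a ha hb
    · rw [Function.update_self]
  upper a ha hb := by
    rcases (Nat.succ_le_of_lt ha).lt_or_eq with ha | rfl
    · rw [Function.update_of_ne (by omega)]
      exact h.upper a ha hb
    · rw [Function.update_self]
      exact h.le_col
  main h0 := by
    subst h0
    exact Or.inr ⟨h.le_diag, Function.update_self ..⟩

/-- The element in column `k + 1` is not taken. -/
theorem skip (h : Trace X K D c (k + 1) (d + 1))
    (he : lightest X (k + 1 + (d + 1)) (k + 1) = lightest X (k + (d + 1)) k) :
    Trace X K D c k (d + 1) where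
  weight := by rw [h.weight, he]
  le_col := (Nat.le_succ k).trans h.le_col
  le_diag := h.le_diag
  mono := h.mono
  lower a ha hb := (Nat.le_succ k).trans (h.lower a ha hb)
  upper := h.upper
  main h0 := by omega

theorem isStart (h : Trace X K D c k 0) :
    IsStart (Function.update c 0 k) D K ∧ lightest X (K + D) K =
      ∑ t ∈ range (D + 1), X (Function.update c 0 k t + t) (Function.update c 0 k t) := by
  refine ⟨⟨?_, ?_, ?_, ?_⟩, ?_⟩
  · intro a b hab hb
    rcases Nat.eq_zero_or_pos a with rfl | ha
    · rw [Function.update_self]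
      rcases Nat.eq_zero_or_pos b with rfl | hb'
      · rw [Function.update_self]
      · rw [Function.update_of_ne hb'.ne']
        exact h.lower b hb' hb
    · rw [Function.update_of_ne ha.ne', Function.update_of_ne (by omega)]
      exact h.mono a b ha hab hb
  · rcases Nat.eq_zero_or_pos D with rfl | hD
    · rw [Function.update_self]
      exact h.le_col
    · rw [Function.update_of_ne hD.ne']
      exact h.upper D hD le_rfl
  · intro hD
    rw [Function.update_self, Function.update_of_ne one_ne_zero]
    rcases h.main rfl with h' | h'
    · omega
    · exact h'.2.symm
  · intro hD
    rw [Function.update_self]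
    rcases h.main rfl with h' | h'
    · exact h'.2
    · omega
  · rw [h.weight, Finset.range_eq_Ico, Finset.sum_eq_sum_Ico_succ_bot (Nat.succ_pos D),
      Function.update_self, add_zero, lightest_diag, zero_add]
    congr 1
    refine Finset.sum_congr rfl fun t ht => ?_
    rw [Function.update_of_ne (by have := (Finset.mem_Ico.1 ht).1; omega)]

end Trace

/-- The recursion is attained by a shifted column. -/
theorem exists_isStart (X : ℕ → ℕ → ℝ) (K D : ℕ) :
    ∃ c, IsStart c D K ∧ lightest X (K + D) K = ∑ t ∈ range (D + 1), X (c t + t) (c t) := by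
  suffices h : ∀ n k d c, n = k + d → Trace X K D c k d → ∃ c k, Trace X K D c k 0 by
    obtain ⟨c, k, h⟩ := h _ K D id rfl (Trace.start X K D id)
    exact ⟨_, h.isStart⟩
  intro n
  induction n with
  | zero =>
    intro k d c hn h
    obtain rfl : d = 0 := by omega
    exact ⟨c, k, h⟩
  | succ n ih =>
    intro k d c hn h
    rcases d with _ | d
    · exact ⟨c, k, h⟩
    · rcases k with _ | k
      · exact ih 0 d _ (by omega) (h.take (lightest_zero X (by omega)))
      · have hmin := lightest_eq_min X (i := k + 1 + (d + 1)) (j := k + 1) (by omega) (by omega)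
        rcases min_choice (lightest X (k + 1 + (d + 1) - 1) (k + 1) +
          X (k + 1 + (d + 1)) (k + 1)) (lightest X (k + 1 + (d + 1) - 1) (k + 1 - 1)) with he | he
        · exact ih (k + 1) d _ (by omega) (h.take (hmin.trans he))
        · refine ih k (d + 1) _ (by omega) (h.skip ?_)
          rw [hmin, he, show k + 1 + (d + 1) - 1 = k + (d + 1) by omega, Nat.add_sub_cancel]

/-! ### The system in terms of lightest shifted columns -/

/-- The constraints with the exponentially many shifted columns replaced by the lightest ones. -/
structure Checks (p q : ℕ) (X : ℕ → ℕ → ℝ) : Prop where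
  supp : ∀ i j, ¬ (i < p ∧ j < q ∧ j ≤ i) → X i j = 0
  row : ∀ i < p, ∑ k ∈ range q, X i k ≤ 1
  nonneg : ∀ i j, i < p → j < q → j ≤ i → ¬ (i = j ∧ j + 1 < q) → 0 ≤ X i j
  bar : ∀ i j, i + 1 < p → j + 1 < q → j ≤ i → ∑ k ∈ Ico (j + 1) q, X (i + 1) k ≤ lightest X i j

theorem shiftedColumnIneq_apply {p q : ℕ} (x : Tri p q → ℝ) (i j : ℕ) (c : ℕ → ℕ) :
    (shiftedColumnIneq p q i j c).lhs x =
      ∑ k ∈ Ico j q, entry x i k - ∑ t ∈ range (i - j + 1), entry x (c t + t) (c t) := by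
  rw [shiftedColumnIneq, LinearMap.sub_apply, sumOver_bar, sumOver_shiftedColumn]

theorem IsStart.isReducedShift {p q i j : ℕ} {c : ℕ → ℕ} (hi : i + 1 < p) (hj : j + 1 < q)
    (hji : j ≤ i) (hc : IsStart c (i - j) j) : IsReducedShift p q (i + 1) (j + 1) c := by
  have hd : i + 1 - (j + 1) = i - j := by omega
  refine ⟨hi, hj, by omega, by omega, ?_, ?_, ?_, ?_⟩
  · rw [hd]
    exact hc.mono
  · rw [hd]
    exact Nat.lt_succ_of_le hc.last
  · exact fun h => hc.two (by omega)
  · exact fun h => by rw [hc.one (by omega)]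

/-- The shifted columns that attain `lightest` are among those of the system. -/
theorem checks_of_mem_solutions {p q : ℕ} {x : Tri p q → ℝ}
    (hx : x ∈ solutions (packingSystem p q)) : Checks p q (entry x) where
  supp i j h := entry_of_not x h
  row i hi := by
    have := hx _ (Or.inl (Or.inl ⟨i, hi, rfl⟩))
    rwa [rowIneq, sumOver_rowSet] at this
  nonneg i j hi hj hji h := by
    have := hx _ (Or.inl (Or.inr ⟨i, j, hi, hj, hji, h, rfl⟩))
    rw [nonnegIneq, LinearMap.neg_apply, sumOver_position] at this
    linarith
  bar i j hi hj hji := by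
    obtain ⟨c, hc, hs⟩ := exists_isStart (entry x) j (i - j)
    have := hx _ (Or.inr ⟨i + 1, j + 1, c, hc.isReducedShift hi hj hji, rfl⟩)
    rw [shiftedColumnIneq_apply, show i + 1 - (j + 1) = i - j by omega, ← hs,
      Nat.add_sub_cancel' hji] at this
    change _ ≤ (0 : ℝ) at this
    linarith

/-! ### Validity of the system -/

theorem entry_vert {p q : ℕ} {F : ℕ → ℕ → Prop} (hF : IsLadder F) {i j : ℕ} (hi : i < p)
    (hj : j < q) : entry (vert p q F) i j = ind F i j := by
  by_cases h : j ≤ i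
  · rw [entry, dif_pos ⟨hi, hj, h⟩]
    rfl
  · rw [entry_of_not _ (by omega), ind_of_not]
    exact fun hF' => h (hF.le hF')

theorem ind_nonneg (F : ℕ → ℕ → Prop) (i j : ℕ) : 0 ≤ ind F i j := by
  by_cases h : F i j
  · rw [ind_of h]; exact zero_le_one
  · rw [ind_of_not h]

/-- A ladder that has entered the column `j` by row `i` meets every shifted column that ends on the
diagonal of `(i, j)` and stays in the columns up to `j`. -/
theorem IsLadder.meets {F : ℕ → ℕ → Prop} (hF : IsLadder F) {c : ℕ → ℕ} {d : ℕ}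
    (hc : ∀ a b, a ≤ b → b ≤ d → c a ≤ c b) {i j : ℕ} (hd : i = j + d) (hcd : c d ≤ j)
    (h : ∃ i' ≤ i, F i' j) : ∃ t ≤ d, F (c t + t) (c t) := by
  induction i generalizing j d with
  | zero =>
    obtain ⟨i', hi', h⟩ := h
    obtain rfl : i' = 0 := by omega
    obtain rfl : j = 0 := by omega
    obtain rfl : d = 0 := by omega
    exact ⟨0, le_rfl, by rwa [show c 0 = 0 by omega]⟩
  | succ i ih =>
    obtain ⟨i', hi', h⟩ := h
    rcases hcd.lt_or_eq with hlt | heq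
    · -- the column to the left of `j` has been entered earlier
      obtain ⟨j, rfl⟩ : ∃ j', j = j' + 1 := ⟨j - 1, by omega⟩
      obtain ⟨i'', h₁, h₂⟩ := hF.start h
      exact ih hc (by omega) (by omega) ⟨i'', by omega, h₂⟩
    · rcases hi'.lt_or_eq with h' | h'
      · rcases d with _ | d
        · have := hF.le h
          omega
        · obtain ⟨t, ht, h₃⟩ := ih (d := d) (fun a b hab hb => hc a b hab (by omega)) (by omega)
            ((hc d (d + 1) (by omega) le_rfl).trans hcd) ⟨i', by omega, h⟩
          exact ⟨t, by omega, h₃⟩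
      · exact ⟨d, le_rfl, by rw [heq, ← hd, ← h']; exact h⟩

theorem IsLadder.sum_Ico_le {F : ℕ → ℕ → Prop} (hF : IsLadder F) (i a b : ℕ) :
    ∑ k ∈ Ico a b, ind F i k ≤ 1 := by
  by_cases h : ∃ k ∈ Ico a b, F i k
  · obtain ⟨k, hk, hFk⟩ := h
    rw [Finset.sum_eq_single_of_mem k hk, ind_of hFk]
    exact fun l _ hl => ind_of_not fun h' => hl (hF.row h' hFk)
  · push Not at h
    rw [Finset.sum_eq_zero fun k hk => ind_of_not (h k hk)]
    exact zero_le_one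

theorem IsLadder.vert_mem_solutions {p q : ℕ} {F : ℕ → ℕ → Prop}
    (hF : IsLadder F) : vert p q F ∈ solutions (packingSystem p q) := by
  rintro r ((⟨i, hi, rfl⟩ | ⟨i, j, hi, hj, hji, h, rfl⟩) | ⟨i, j, c, hc, rfl⟩)
  · rw [rowIneq, sumOver_rowSet, Finset.range_eq_Ico]
    refine (Finset.sum_congr rfl fun k hk => ?_).trans_le (hF.sum_Ico_le i 0 q)
    exact entry_vert hF hi (Finset.mem_Ico.1 hk).2
  · rw [nonnegIneq, LinearMap.neg_apply, sumOver_position, entry_vert hF hi hj]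
    exact neg_nonpos.2 (ind_nonneg F i j)
  · obtain ⟨hi, hj, h1j, hji, hmono, hlast, -, -⟩ := hc
    rw [shiftedColumnIneq_apply]
    change _ ≤ (0 : ℝ)
    have hbar : ∑ k ∈ Ico j q, entry (vert p q F) i k = ∑ k ∈ Ico j q, ind F i k :=
      Finset.sum_congr rfl fun k hk => entry_vert hF hi (Finset.mem_Ico.1 hk).2
    have hcol : ∀ t ≤ i - j, c t + t < p ∧ c t < q := fun t ht => by
      have := hmono t (i - j) ht le_rfl
      omega
    have hS : ∑ t ∈ range (i - j + 1), entry (vert p q F) (c t + t) (c t) =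
        ∑ t ∈ range (i - j + 1), ind F (c t + t) (c t) :=
      Finset.sum_congr rfl fun t ht => by
        have := hcol t (by have := Finset.mem_range.1 ht; omega)
        exact entry_vert hF this.1 this.2
    rw [hbar, hS, sub_nonpos]
    by_cases h : ∃ k ∈ Ico j q, F i k
    · obtain ⟨k, hk, hFk⟩ := h
      obtain ⟨i', hi', h'⟩ :=
        hF.exists_of_lt (k := j - 1) hFk (by have := (Finset.mem_Ico.1 hk).1; omega)
      obtain ⟨t, ht, h3⟩ := hF.meets (i := i - 1) (j := j - 1) hmono (by omega) (by omega)
        ⟨i', by omega, h'⟩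
      refine (hF.sum_Ico_le i j q).trans ?_
      rw [← ind_of h3]
      exact Finset.single_le_sum (f := fun t => ind F (c t + t) (c t))
        (fun t _ => ind_nonneg F _ _) (Finset.mem_range.2 (by omega))
    · push Not at h
      rw [Finset.sum_eq_zero fun k hk => ind_of_not (h k hk)]
      exact Finset.sum_nonneg fun t _ => ind_nonneg F _ _

theorem convex_solutions {ι : Type} (sys : Set (LinIneq ι)) : Convex ℝ (solutions sys) := by
  intro x hx y hy a b ha hb hab r hr
  rw [map_add, map_smul, map_smul, smul_eq_mul, smul_eq_mul]
  calc a * r.lhs x + b * r.lhs y ≤ a * r.rhs + b * r.rhs := by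
        gcongr
        · exact hx r hr
        · exact hy r hr
    _ = r.rhs := by rw [← add_mul, hab, one_mul]

theorem symPackingOrbitope_subset (p q : ℕ) :
    symPackingOrbitope p q ⊆ solutions (packingSystem p q) := by
  rw [symPackingOrbitope_eq]
  refine convexHull_min ?_ (convex_solutions _)
  rintro _ ⟨F, hF, rfl⟩
  exact hF.vert_mem_solutions


/-! ### Consequences of the constraints -/

namespace Checks

variable {p q : ℕ} {X : ℕ → ℕ → ℝ}

theorem upper (h : Checks p q X) {i j : ℕ} (hij : i < j) : X i j = 0 := h.supp i j (by omega)

theorem sum_Ico_self (h : Checks p q X) (k : ℕ) : ∑ l ∈ Ico k q, X k l = X k k := by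
  by_cases hk : k < q
  · rw [Finset.sum_eq_single_of_mem k (Finset.mem_Ico.2 ⟨le_rfl, hk⟩)]
    intro l hl hlk
    exact h.upper (by have := (Finset.mem_Ico.1 hl).1; omega)
  · rw [Finset.Ico_eq_empty (by omega), Finset.sum_empty, h.supp k k (by omega)]

theorem diag_le_of_lt (h : Checks p q X) (hqp : q ≤ p) {k : ℕ} (hk : k + 1 < q) :
    X (k + 1) (k + 1) ≤ X k k := by
  have := h.bar k k (by omega) hk le_rfl
  rwa [lightest_diag, h.sum_Ico_self] at this

theorem nonneg' (h : Checks p q X) (hqp : q ≤ p) (i j : ℕ) : 0 ≤ X i j := by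
  by_cases hij : i < p ∧ j < q ∧ j ≤ i
  · by_cases hd : i = j ∧ j + 1 < q
    · obtain ⟨rfl, -⟩ := hd
      obtain ⟨n, hn⟩ : ∃ n, i + n + 1 = q := ⟨q - i - 1, by omega⟩
      induction n generalizing i with
      | zero => exact h.nonneg i i hij.1 hij.2.1 le_rfl (by omega)
      | succ n ih =>
        exact (ih (i + 1) (by omega) (by omega)).trans (h.diag_le_of_lt hqp (by omega))
    · exact h.nonneg i j hij.1 hij.2.1 hij.2.2 hd
  · rw [h.supp i j hij]

theorem diag_le (h : Checks p q X) (hqp : q ≤ p) (k : ℕ) : X (k + 1) (k + 1) ≤ X k k := by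
  by_cases hk : k + 1 < q
  · exact h.diag_le_of_lt hqp hk
  · rw [h.supp (k + 1) (k + 1) (by omega)]
    exact h.nonneg' hqp k k

theorem lightest_nonneg (h : Checks p q X) (hqp : q ≤ p) (m k : ℕ) : 0 ≤ lightest X m k := by
  induction m generalizing k with
  | zero => exact h.nonneg' hqp 0 k
  | succ m ih =>
    rcases k with _ | k
    · exact add_nonneg (ih 0) (h.nonneg' hqp _ _)
    · rw [lightest]
      split_ifs
      · exact le_min (add_nonneg (ih _) (h.nonneg' hqp _ _)) (ih _)
      · exact h.nonneg' hqp _ _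

theorem lightest_upper (h : Checks p q X) {m k : ℕ} (hmk : m < k) : lightest X m k = 0 := by
  rw [lightest_of_le X hmk.le, h.upper hmk]

theorem lightest_succ_succ (h : Checks p q X) (hqp : q ≤ p) (m k : ℕ) :
    lightest X (m + 1) (k + 1) ≤ lightest X m k := by
  rcases lt_trichotomy k m with hk | rfl | hk
  · rw [lightest, if_pos hk]
    exact min_le_right _ _
  · rw [lightest_diag, lightest_diag]
    exact h.diag_le hqp k
  · rw [h.lightest_upper (by omega)]
    exact h.lightest_nonneg hqp m k

theorem lightest_mono (h : Checks p q X) (hqp : q ≤ p) (m k : ℕ) :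
    lightest X m k ≤ lightest X (m + 1) k := by
  induction m generalizing k with
  | zero =>
    rcases k with _ | k
    · exact le_add_of_nonneg_right (h.nonneg' hqp _ _)
    · rw [h.lightest_upper (Nat.succ_pos k)]
      exact h.lightest_nonneg hqp _ _
  | succ m ih =>
    rcases k with _ | k
    · exact le_add_of_nonneg_right (h.nonneg' hqp _ _)
    · by_cases hk : k < m + 1
      · rw [lightest.eq_3 X (m + 1), if_pos hk]
        exact le_min (le_add_of_nonneg_right (h.nonneg' hqp _ _))
          ((h.lightest_succ_succ hqp m k).trans (ih k))
      · rw [h.lightest_upper (by omega)]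
        exact h.lightest_nonneg hqp _ _

theorem lightest_succ_le (h : Checks p q X) (hqp : q ≤ p) (m k : ℕ) :
    lightest X (m + 1) k ≤ lightest X m k + X (m + 1) k := by
  rcases k with _ | k
  · rfl
  · rw [lightest]
    split_ifs
    · exact min_le_left _ _
    · exact le_add_of_nonneg_left (h.lightest_nonneg hqp _ _)

theorem bar_le_lightest (h : Checks p q X) (hqp : q ≤ p) (m k : ℕ) (hm : m < p) (hk : k < q) :
    ∑ l ∈ Ico k q, X m l ≤ lightest X m k := by
  -- the constraint for the bar to the right of `(m, k)`
  have right : ∀ m k, m + 1 < p → k ≤ m → ∑ l ∈ Ico (k + 1) q, X (m + 1) l ≤ lightest X m k := by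
    intro m k hm hk
    by_cases hq : k + 1 < q
    · exact h.bar m k hm hq hk
    · rw [Finset.Ico_eq_empty (by omega), Finset.sum_empty]
      exact h.lightest_nonneg hqp m k
  rcases le_or_gt m k with hmk | hmk
  · rw [lightest_of_le X hmk]
    rcases hmk.lt_or_eq with hlt | rfl
    · rw [h.upper hlt, Finset.sum_eq_zero]
      intro l hl
      exact h.upper (by have := (Finset.mem_Ico.1 hl).1; omega)
    · rw [h.sum_Ico_self]
  · obtain ⟨m, rfl⟩ : ∃ m', m = m' + 1 := ⟨m - 1, by omega⟩
    have hadd : ∑ l ∈ Ico k q, X (m + 1) l ≤ lightest X m k + X (m + 1) k := by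
      rw [Finset.sum_eq_sum_Ico_succ_bot hk, add_comm]
      gcongr
      exact right m k hm (by omega)
    rcases k with _ | k
    · exact hadd
    · rw [lightest, if_pos (by omega)]
      exact le_min hadd (h.bar m k hm hk (by omega))

end Checks

/-! ### The distribution of the number of entered columns -/

/-- In the random ladder with expectation `X`, the probability that at least `k` columns have been
entered before row `m`. There are only `q` columns, so this is `0` for `k > q`. -/
noncomputable def reach (X : ℕ → ℕ → ℝ) (q : ℕ) : ℕ → ℕ → ℝ
  | _, 0 => 1
  | 0, _ + 1 => 0
  | m + 1, k + 1 => if k < q then min 1 (lightest X m k) else 0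

namespace Checks

variable {p q : ℕ} {X : ℕ → ℕ → ℝ}

theorem reach_zero (m : ℕ) : reach X q m 0 = 1 := by cases m <;> rfl

theorem reach_mono (h : Checks p q X) (hqp : q ≤ p) (m k : ℕ) :
    reach X q m k ≤ reach X q (m + 1) k := by
  rcases k with _ | k
  · rw [reach_zero, reach_zero]
  · rcases m with _ | m
    · rw [reach, reach]
      split_ifs
      · exact le_min zero_le_one (h.lightest_nonneg hqp _ _)
      · exact le_rfl
    · rw [reach, reach]
      split_ifs
      · exact min_le_min_left _ (h.lightest_mono hqp m k)
      · exact le_rfl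

theorem reach_succ_le_add (h : Checks p q X) (hqp : q ≤ p) (m k : ℕ) :
    reach X q (m + 1) (k + 1) ≤ reach X q m (k + 1) + X m k := by
  rw [reach]
  split_ifs with hk
  · rcases m with _ | m
    · rw [reach, zero_add]
      exact min_le_right _ _
    · rw [reach, if_pos hk, ← min_add_add_right]
      exact le_min ((min_le_left _ _).trans (le_add_of_nonneg_right (h.nonneg' hqp _ _)))
        ((min_le_right _ _).trans (h.lightest_succ_le hqp m k))
  · rcases m with _ | m
    · rw [reach, zero_add]
      exact h.nonneg' hqp _ _
    · rw [reach, if_neg hk, zero_add]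
      exact h.nonneg' hqp _ _

theorem reach_succ_succ (h : Checks p q X) (hqp : q ≤ p) (m k : ℕ) :
    reach X q (m + 1) (k + 1) ≤ reach X q m k := by
  rcases k with _ | k
  · rw [reach_zero, reach]
    split_ifs
    · exact min_le_left _ _
    · exact zero_le_one
  · rcases m with _ | m
    · rw [reach, reach]
      split_ifs
      · exact (min_le_right _ _).trans_eq (h.upper (Nat.succ_pos k))
      · exact le_rfl
    · by_cases hk : k + 1 < q
      · rw [reach, reach, if_pos hk, if_pos (by omega)]
        exact min_le_min_left _ (h.lightest_succ_succ hqp m k)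
      · rw [reach, if_neg hk, reach]
        split_ifs
        · exact le_min zero_le_one (h.lightest_nonneg hqp _ _)
        · exact le_rfl

theorem bar_le_reach (h : Checks p q X) (hqp : q ≤ p) (m k : ℕ) (hm : m < p) :
    ∑ l ∈ Ico k q, X m l ≤ reach X q (m + 1) (k + 1) := by
  rw [reach]
  split_ifs with hk
  · refine le_min ?_ (h.bar_le_lightest hqp m k hm hk)
    refine le_trans ?_ (h.row m hm)
    rw [Finset.range_eq_Ico]
    exact Finset.sum_le_sum_of_subset_of_nonneg (Finset.Ico_subset_Ico_left (Nat.zero_le k))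
      fun l _ _ => h.nonneg' hqp m l
  · rw [Finset.Ico_eq_empty (by omega), Finset.sum_empty]

end Checks

/-! ### The monotone transport plan -/

/-- The length of the intersection of the intervals `[W (k + 1), W k]` and `[V (l + 1), V l]`: the
mass that the monotone transport plan moves from `k` to `l` if `W` and `V` are the masses of the
upper sets of the source and of the target. -/
noncomputable def plan (W V : ℕ → ℝ) (k l : ℕ) : ℝ :=
  max 0 (min (W k) (V l) - max (W (k + 1)) (V (l + 1)))

theorem plan_comm (W V : ℕ → ℝ) (k l : ℕ) : plan W V k l = plan V W l k := by
  rw [plan, plan, min_comm, max_comm (W (k + 1))]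

theorem plan_nonneg (W V : ℕ → ℝ) (k l : ℕ) : 0 ≤ plan W V k l := le_max_left _ _

theorem plan_eq_zero {W V : ℕ → ℝ} (hV : Antitone V) (h : ∀ l, V l ≤ W l) {k l : ℕ} (hkl : k < l) :
    plan W V k l = 0 := by
  refine max_eq_left (sub_nonpos.2 ?_)
  calc min (W k) (V l) ≤ V l := min_le_right _ _
    _ ≤ V (k + 1) := hV hkl
    _ ≤ W (k + 1) := h _
    _ ≤ _ := le_max_left _ _

theorem sum_plan {W V : ℕ → ℝ} (hW : Antitone W) (hV : Antitone V) {n : ℕ} (h0 : W 0 = V 0)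
    (hn : W n = V n) {k : ℕ} (hk : k < n) :
    ∑ l ∈ range n, plan W V k l = W k - W (k + 1) := by
  -- each term is the increment of the projection onto `[W (k + 1), W k]`
  have hterm : ∀ l, plan W V k l =
      max (W (k + 1)) (min (W k) (V l)) - max (W (k + 1)) (min (W k) (V (l + 1))) := by
    intro l
    have h1 := hW (Nat.le_succ k)
    have h2 := hV (Nat.le_succ l)
    rw [Nat.succ_eq_add_one] at h1 h2
    unfold plan
    rcases le_total (W k) (V l) with a | a <;> rcases le_total (W k) (V (l + 1)) with b | b <;>
      rcases le_total (W (k + 1)) (V (l + 1)) with c | c <;>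
      rcases le_total (W (k + 1)) (V l) with d | d <;>
      simp only [min_eq_left a, min_eq_right a, min_eq_left b, min_eq_right b, max_eq_left c,
        max_eq_right c, max_eq_left d, max_eq_right d, max_eq_right h1] <;>
      first
        | exact max_eq_right (by linarith)
        | exact (max_eq_left (by linarith)).trans (by linarith)
  rw [Finset.sum_congr rfl fun l _ => hterm l, Finset.sum_range_sub', ← h0, ← hn,
    min_eq_left (hW (Nat.zero_le k)), max_eq_right (hW (Nat.le_succ k)),
    min_eq_right (hW hk.le), max_eq_left (hW hk)]


/-! ### Random ladders, row by row -/

/-- `G k` and `G' k` are the probabilities that at least `k` columns have been entered before and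
after a row with expectation `ξ`. The rows that do not enter a new column can be filled: `z k l` is
the probability that `k` columns have been entered and the row has its `1` in column `l - 1` among
them (nowhere if `l = 0`). -/
theorem exists_plan {q : ℕ} {G G' ξ : ℕ → ℝ} (hG0 : G 0 = 1) (hG'0 : G' 0 = 1)
    (hG : ∀ k, q < k → G k = 0) (hG' : ∀ k, q < k → G' k = 0)
    (h₂ : ∀ k, G' (k + 1) ≤ G (k + 1) + ξ k) (h₃ : ∀ k, G' (k + 1) ≤ G k)
    (hξ : ∀ k, q ≤ k → ξ k = 0) (h₄ : ∀ k, ∑ l ∈ Ico k q, ξ l ≤ G' (k + 1)) :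
    ∃ z : ℕ → ℕ → ℝ, (∀ k l, 0 ≤ z k l) ∧ (∀ k l, k < l → z k l = 0) ∧
      (∀ k ≤ q, ∑ l ∈ range (q + 1), z k l = G k - G' (k + 1)) ∧
      (∀ j < q, ∑ k ∈ range (q + 1), z k (j + 1) = ξ j + G (j + 1) - G' (j + 1)) := by
  -- `b`, `W` and `V` are weights of upper sets: of the bars in the row, with `b 0` including the
  -- possibility that the row has no `1`, of the numbers of columns for the rows that enter no new
  -- column, and of the positions that these rows occupy
  let b : ℕ → ℝ := fun k => Nat.casesOn k 1 fun j => ∑ l ∈ Ico j q, ξ l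
  let W : ℕ → ℝ := fun k => ∑ l ∈ Ico k (q + 1), (G l - G' (l + 1))
  let V : ℕ → ℝ := fun k => W k - G' k + b k
  have hb : ∀ j, b (j + 1) - b (j + 2) = ξ j := by
    intro j
    change ∑ l ∈ Ico j q, ξ l - ∑ l ∈ Ico (j + 1) q, ξ l = ξ j
    by_cases hj : j < q
    · rw [Finset.sum_eq_sum_Ico_succ_bot hj, add_sub_cancel_right]
    · rw [Finset.Ico_eq_empty (by omega), Finset.Ico_eq_empty (by omega), hξ j (by omega)]
      simp
  have hbG : ∀ k, b k ≤ G' k := by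
    rintro (_ | k)
    · exact hG'0.ge
    · exact h₄ k
  have hW : ∀ k, W k - W (k + 1) = G k - G' (k + 1) := by
    intro k
    simp only [W]
    by_cases hk : k < q + 1
    · rw [Finset.sum_eq_sum_Ico_succ_bot hk, add_sub_cancel_right]
    · rw [Finset.Ico_eq_empty (by omega), Finset.Ico_eq_empty (by omega), hG k (by omega),
        hG' _ (by omega)]
      simp
  have hV : ∀ k, V k - V (k + 1) = G k - G' k + (b k - b (k + 1)) := by
    intro k
    have := hW k
    simp only [V]
    linarith
  have hWanti : Antitone W := antitone_nat_of_succ_le fun k => by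
    linarith [hW k, h₃ k]
  have hVanti : Antitone V := antitone_nat_of_succ_le fun k => by
    have h := hV k
    rcases k with _ | k
    · have h5 : b 1 ≤ 1 := ((h₄ 0).trans (h₃ 0)).trans_eq hG0
      have h6 : b 0 = 1 := rfl
      rw [zero_add] at *
      linarith
    · linarith [hb k, h₂ k]
  have hVW : ∀ k, V k ≤ W k := fun k => by
    have := hbG k
    simp only [V]
    linarith
  have h0 : W 0 = V 0 := by
    have h6 : b 0 = 1 := rfl
    simp only [V]
    linarith
  have hn : W (q + 1) = V (q + 1) := by
    have h6 : b (q + 1) = 0 := by simp [b]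
    simp only [V]
    rw [h6, hG' _ (Nat.lt_succ_self q)]
    ring
  refine ⟨plan W V, plan_nonneg W V, fun k l => plan_eq_zero hVanti hVW, fun k hk => ?_,
    fun j hj => ?_⟩
  · rw [sum_plan hWanti hVanti h0 hn (Nat.lt_succ_of_le hk), hW]
  · simp only [plan_comm W V _ (j + 1)]
    rw [sum_plan hVanti hWanti h0.symm hn.symm (by omega), hV, hb]
    ring

/-- The ladders within the first `m` rows and the first `q` columns, paired with the unit vector
that indicates the number of columns that they enter. -/
def partialLadders (q m : ℕ) : Set ((ℕ → ℕ → ℝ) × (ℕ → ℝ)) :=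
  {v | ∃ F k, IsLadder F ∧ k ≤ q ∧ (∀ i j, F i j → i < m ∧ j < k) ∧
    (∀ j < k, ∃ i < m, F i j) ∧ v = (ind F, Pi.single k 1)}

/-- A weighted mean of points `a + v l` of a convex set; nothing is assumed where the weight is
zero. -/
theorem Convex.add_inv_smul_sum_mem {E ι : Type*} [AddCommGroup E] [Module ℝ E] {C : Set E}
    (hC : Convex ℝ C) (t : Finset ι) (a : E) (v : ι → E) {ω : ι → ℝ} {y : ℝ} (hω : ∀ l, 0 ≤ ω l)
    (hy : 0 < y) (hsum : ∑ l ∈ t, ω l = y) (hmem : ∀ l ∈ t, ω l ≠ 0 → a + v l ∈ C) :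
    a + y⁻¹ • ∑ l ∈ t, ω l • v l ∈ C := by
  have h1 : ∑ l ∈ t with ω l ≠ 0, y⁻¹ * ω l = 1 := by
    rw [← Finset.mul_sum, Finset.sum_filter_ne_zero, hsum, inv_mul_cancel₀ hy.ne']
  have h2 : a + y⁻¹ • ∑ l ∈ t, ω l • v l = ∑ l ∈ t with ω l ≠ 0, (y⁻¹ * ω l) • (a + v l) := by
    simp only [smul_add, Finset.sum_add_distrib]
    rw [← Finset.sum_smul, h1, one_smul, Finset.smul_sum]
    congr 1
    rw [Finset.sum_filter]
    refine Finset.sum_congr rfl fun l _ => ?_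
    split_ifs with h
    · rw [mul_smul]
    · rw [not_not.1 h, zero_smul, smul_zero]
  rw [h2]
  refine hC.sum_mem (fun l _ => mul_nonneg (inv_nonneg.2 hy.le) (hω l)) h1 fun l hl => ?_
  rw [Finset.mem_filter] at hl
  exact hmem l hl.1 hl.2

/-- A partial ladder with `k` columns stays one with `k` columns if the next row has its `1` in
column `l - 1 < k`, or no `1` if `l = 0`. -/
theorem extend_same {q m k : ℕ} {F : ℕ → ℕ → Prop} (hF : IsLadder F) (hk : k ≤ q)
    (hsupp : ∀ i j, F i j → i < m ∧ j < k) (hcol : ∀ j < k, ∃ i < m, F i j) {l : ℕ} (hl : l ≤ k) :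
    (ind F + ind fun a b => a = m ∧ b + 1 = l, Pi.single k 1) ∈ partialLadders q (m + 1) := by
  rcases l with _ | l
  · refine ⟨F, k, hF, hk, fun i j h => ?_, fun j hj => ?_, ?_⟩
    · have := hsupp i j h
      omega
    · obtain ⟨i, hi, h⟩ := hcol j hj
      exact ⟨i, by omega, h⟩
    · congr 1
      funext a b
      simp [ind]
  · have hno : ∀ b, ¬ F m b := fun b h => lt_irrefl _ (hsupp m b h).1
    refine ⟨fun a b => F a b ∨ (a = m ∧ b = l), k, hF.insert hno ?_, hk, ?_, ?_, ?_⟩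
    · rintro l rfl
      exact hcol l (by omega)
    · rintro i j (h | ⟨rfl, rfl⟩)
      · have := hsupp i j h
        omega
      · omega
    · intro j hj
      obtain ⟨i, hi, h⟩ := hcol j hj
      exact ⟨i, by omega, Or.inl h⟩
    · rw [ind_insert (hno l)]
      simp only [Nat.add_right_cancel_iff]

/-- A partial ladder with `k` columns is extended by entering column `k` in the next row. -/
theorem extend_new {q m k : ℕ} {F : ℕ → ℕ → Prop} (hF : IsLadder F) (hk : k < q)
    (hsupp : ∀ i j, F i j → i < m ∧ j < k) (hcol : ∀ j < k, ∃ i < m, F i j) :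
    (ind F + ind fun a b => a = m ∧ b = k, Pi.single (k + 1) 1) ∈ partialLadders q (m + 1) := by
  have hno : ∀ b, ¬ F m b := fun b h => lt_irrefl _ (hsupp m b h).1
  refine ⟨fun a b => F a b ∨ (a = m ∧ b = k), k + 1, hF.insert hno ?_, hk, ?_, ?_, ?_⟩
  · rintro l rfl
    exact hcol l (by omega)
  · rintro i j (h | ⟨rfl, rfl⟩)
    · have := hsupp i j h
      omega
    · omega
  · intro j hj
    rcases Nat.lt_succ_iff_lt_or_eq.1 hj with hj | rfl
    · obtain ⟨i, hi, h⟩ := hcol j hj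
      exact ⟨i, by omega, Or.inl h⟩
    · exact ⟨m, by omega, Or.inr ⟨rfl, rfl⟩⟩
  · rw [ind_insert (hno k)]

theorem mul_ind_sum {n : ℕ} (f : ℕ → ℝ) (b : ℕ) :
    ∑ k ∈ range n, f k * (if b = k then 1 else 0) = if b < n then f b else 0 := by
  simp [Finset.sum_ite_eq]

/-- A random ladder on `m` rows extends to one on `m + 1` rows: given that `k` columns have been
entered, the choice in the new row is drawn from the transport plan, independently of the rest. -/
theorem convexHull_step {q m : ℕ} {G G' ξ : ℕ → ℝ} (hG0 : G 0 = 1) (hG'0 : G' 0 = 1)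
    (hG : ∀ k, q < k → G k = 0) (hG' : ∀ k, q < k → G' k = 0) (h₁ : ∀ k, G k ≤ G' k)
    (h₂ : ∀ k, G' (k + 1) ≤ G (k + 1) + ξ k)
    (h₃ : ∀ k, G' (k + 1) ≤ G k) (hξ : ∀ k, q ≤ k → ξ k = 0)
    (h₄ : ∀ k, ∑ l ∈ Ico k q, ξ l ≤ G' (k + 1)) {M : ℕ → ℕ → ℝ}
    (hM : (M, fun k => G k - G (k + 1)) ∈ convexHull ℝ (partialLadders q m)) :
    (M + fun a b => if a = m then ξ b else 0, fun k => G' k - G' (k + 1)) ∈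
      convexHull ℝ (partialLadders q (m + 1)) := by
  obtain ⟨z, hz, hz0, hzk, hzj⟩ := exists_plan hG0 hG'0 hG hG' h₂ h₃ hξ h₄
  let y : ℕ → ℝ := fun k => G k - G (k + 1)
  let u : ℕ → ℝ := fun k => G' (k + 1) - G (k + 1)
  -- the choice in the new row and the new number of columns, weighted with the probabilities
  let S : ℕ → (ℕ → ℕ → ℝ) × (ℕ → ℝ) := fun k =>
    ∑ l ∈ range (q + 1), z k l • (ind fun a b => a = m ∧ b + 1 = l, Pi.single k 1) +
      u k • (ind fun a b => a = m ∧ b = k, Pi.single (k + 1) 1)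
  let R : ℕ → (ℕ → ℕ → ℝ) × (ℕ → ℝ) := fun k =>
    if y k = 0 then (0, Pi.single k 1) else (y k)⁻¹ • S k
  let T : (ℕ → ℕ → ℝ) × (ℕ → ℝ) →ₗ[ℝ] (ℕ → ℕ → ℝ) × (ℕ → ℝ) :=
    { toFun := fun v => (v.1, 0) + ∑ k ∈ range (q + 1), v.2 k • R k
      map_add' := fun v w => by
        simp only [Prod.fst_add, Prod.snd_add, Pi.add_apply, add_smul, Finset.sum_add_distrib]
        rw [show (v.1 + w.1, (0 : ℕ → ℝ)) = (v.1, 0) + (w.1, 0) by simp]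
        abel
      map_smul' := fun r v => by
        simp only [Prod.smul_fst, Prod.smul_snd, Pi.smul_apply, smul_eq_mul, mul_smul,
          RingHom.id_apply, smul_add, Finset.smul_sum]
        simp }
  have hu : ∀ k, 0 ≤ u k := fun k => sub_nonneg.2 (h₁ (k + 1))
  have hyu : ∀ k ≤ q, ∑ l ∈ range (q + 1), z k l + u k = y k := fun k hk => by
    rw [hzk k hk]
    simp only [u, y]
    ring
  have hy : ∀ k ≤ q, 0 ≤ y k := fun k hk => by
    rw [← hyu k hk]
    exact add_nonneg (Finset.sum_nonneg fun l _ => hz k l) (hu k)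
  have huq : ∀ k, q ≤ k → u k = 0 := fun k hk => by
    simp only [u]
    rw [hG _ (by omega), hG' _ (by omega), sub_zero]
  have hTmem : ∀ v ∈ convexHull ℝ (partialLadders q m),
      T v ∈ convexHull ℝ (partialLadders q (m + 1)) := by
    refine fun v hv => convexHull_min (t := T ⁻¹' convexHull ℝ (partialLadders q (m + 1))) ?_
      ((convex_convexHull ℝ _).linear_preimage T) hv
    rintro _ ⟨F, k, hF, hk, hsupp, hcol, rfl⟩
    have hT : T (ind F, Pi.single k 1) = (ind F, 0) + R k := by
      change (ind F, (0 : ℕ → ℝ)) + ∑ l ∈ range (q + 1), (Pi.single k 1 : ℕ → ℝ) l • R l = _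
      rw [Finset.sum_eq_single_of_mem k (Finset.mem_range.2 (by omega)), Pi.single_eq_same,
        one_smul]
      intro l _ hl
      rw [Pi.single_eq_of_ne hl, zero_smul]
    rw [Set.mem_preimage, hT]
    simp only [R]
    split_ifs with h0
    · have hmem := extend_same hF hk hsupp hcol (Nat.zero_le k)
      have hnone : (ind fun a b => a = m ∧ b + 1 = 0) = 0 := by
        funext a b
        exact ind_of_not (by omega)
      rw [hnone, add_zero] at hmem
      rw [Prod.mk_add_mk, add_zero, zero_add]
      exact subset_convexHull ℝ _ hmem
    · have hpos : 0 < y k := lt_of_le_of_ne (hy k hk) (Ne.symm h0)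
      have := Convex.add_inv_smul_sum_mem (convex_convexHull ℝ (partialLadders q (m + 1)))
        (range (q + 2)) (ind F, (0 : ℕ → ℝ))
        (fun l => if l = q + 1 then (ind fun a b => a = m ∧ b = k, Pi.single (k + 1) 1)
          else (ind fun a b => a = m ∧ b + 1 = l, Pi.single k 1))
        (ω := fun l => if l = q + 1 then u k else z k l) (y := y k) ?_ hpos ?_ ?_
      · rw [Finset.sum_range_succ, if_pos rfl, if_pos rfl] at this
        convert this using 3
        simp only [S]
        congr 1
        refine Finset.sum_congr rfl fun l hl => ?_
        have : l ≠ q + 1 := by have := Finset.mem_range.1 hl; omega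
        rw [if_neg this, if_neg this]
      · intro l
        split_ifs
        · exact hu k
        · exact hz k l
      · rw [Finset.sum_range_succ, if_pos rfl, ← hyu k hk]
        congr 1
        refine Finset.sum_congr rfl fun l hl => if_neg ?_
        have := Finset.mem_range.1 hl
        omega
      · intro l _ hne
        refine subset_convexHull ℝ _ ?_
        split_ifs at hne ⊢ with hl
        · have hkq : k < q := by
            by_contra h
            exact hne (huq k (by omega))
          rw [Prod.mk_add_mk, zero_add]
          exact extend_new hF hkq hsupp hcol
        · have hlk : l ≤ k := by
            by_contra h
            exact hne (hz0 k l (by omega))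
          rw [Prod.mk_add_mk, zero_add]
          exact extend_same hF hk hsupp hcol hlk
  have hRS : ∀ k ∈ range (q + 1), y k • R k = S k := by
    intro k hk
    have hk' : k ≤ q := by have := Finset.mem_range.1 hk; omega
    simp only [R]
    split_ifs with h0
    · have hsum := hyu k hk'
      rw [h0] at hsum
      have hzs : 0 ≤ ∑ l ∈ range (q + 1), z k l := Finset.sum_nonneg fun l _ => hz k l
      have hu0 : u k = 0 := le_antisymm (by linarith) (hu k)
      have hz00 : ∀ l ∈ range (q + 1), z k l = 0 :=
        (Finset.sum_eq_zero_iff_of_nonneg fun l _ => hz k l).1 (by linarith)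
      simp only [S]
      rw [h0, zero_smul, hu0, zero_smul, add_zero, Finset.sum_eq_zero]
      intro l hl
      rw [hz00 l hl, zero_smul]
    · rw [smul_smul, mul_inv_cancel₀ h0, one_smul]
  have hTM : T (M, y) =
      (M + fun a b => if a = m then ξ b else 0, fun k => G' k - G' (k + 1)) := by
    change (M, (0 : ℕ → ℝ)) + ∑ k ∈ range (q + 1), y k • R k = _
    rw [Finset.sum_congr rfl hRS]
    refine Prod.ext ?_ ?_
    · simp only [Prod.fst_add, Prod.fst_sum]
      congr 1
      funext a b
      simp only [S, Finset.sum_apply, Prod.fst_add, Prod.fst_sum, Prod.smul_fst, Pi.add_apply,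
        Pi.smul_apply, smul_eq_mul]
      by_cases ha : a = m
      · subst ha
        rw [if_pos rfl]
        simp only [ind, true_and]
        rw [Finset.sum_add_distrib, Finset.sum_congr rfl fun k _ => mul_ind_sum (z k) (b + 1),
          mul_ind_sum u b]
        by_cases hb : b < q
        · simp only [if_pos (show b + 1 < q + 1 by omega), if_pos (show b < q + 1 by omega)]
          rw [hzj b hb]
          simp only [u]
          ring
        · simp only [if_neg (show ¬ b + 1 < q + 1 by omega), hξ b (by omega)]
          rw [huq b (by omega)]
          simp
      · rw [if_neg ha]
        simp [ind, ha]
    · simp only [Prod.snd_add, Prod.snd_sum, zero_add]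
      funext k
      simp only [S, Finset.sum_apply, Prod.snd_add, Prod.snd_sum, Prod.smul_snd, Pi.add_apply,
        Pi.smul_apply, smul_eq_mul, Pi.single_apply]
      rw [Finset.sum_add_distrib]
      simp only [← Finset.sum_mul]
      rw [mul_ind_sum (fun k => ∑ l ∈ range (q + 1), z k l) k]
      have hcase : (if k < q + 1 then ∑ l ∈ range (q + 1), z k l else 0) = G k - G' (k + 1) := by
        split_ifs with hk
        · exact hzk k (by omega)
        · rw [hG k (by omega), hG' _ (by omega), sub_zero]
      rw [hcase]
      rcases k with _ | k
      · simp [hG0, hG'0]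
      · simp only [Nat.add_right_cancel_iff]
        rw [mul_ind_sum u k]
        have hcase' : (if k < q + 1 then u k else 0) = u k := by
          split_ifs with hk
          · rfl
          · rw [huq k (by omega)]
        rw [hcase']
        simp only [u]
        ring
  rw [← hTM]
  exact hTmem _ hM

/-- The first `m` rows of a point that passes the checks are the expectation of a random ladder, in
which the number of entered columns is distributed according to `reach`. -/
theorem Checks.mem_convexHull {p q : ℕ} {X : ℕ → ℕ → ℝ} (h : Checks p q X) (hqp : q ≤ p) {m : ℕ}
    (hm : m ≤ p) :
    (fun a b => if a < m then X a b else 0, fun k => reach X q m k - reach X q m (k + 1)) ∈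
      convexHull ℝ (partialLadders q m) := by
  induction m with
  | zero =>
    refine subset_convexHull ℝ _ ⟨fun _ _ => False, 0, isLadder_empty, Nat.zero_le _,
      fun _ _ h => h.elim, fun j hj => by omega, ?_⟩
    refine Prod.ext ?_ ?_
    · funext a b
      simp [ind]
    · funext k
      rcases k with _ | k <;> simp [reach]
  | succ m ih =>
    have hlast : ∀ m k, q < k → reach X q m k = 0 := by
      rintro (_ | m) (_ | k) hk
      · omega
      · rfl
      · omega
      · rw [reach, if_neg (by omega)]
    have := convexHull_step (reach_zero m) (reach_zero (m + 1)) (hlast m) (hlast (m + 1))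
      (h.reach_mono hqp m) (h.reach_succ_le_add hqp m) (h.reach_succ_succ hqp m)
      (fun k hk => h.supp m k (by omega)) (fun k => h.bar_le_reach hqp m k (by omega))
      (ih (by omega))
    convert this using 2
    funext a b
    simp only [Pi.add_apply]
    rcases lt_trichotomy a m with ha | rfl | ha
    · rw [if_pos (by omega), if_pos ha, if_neg (by omega), add_zero]
    · rw [if_pos (by omega), if_neg (by omega), if_pos rfl, zero_add]
    · rw [if_neg (by omega), if_neg (by omega), if_neg (by omega), add_zero]

theorem Checks.mem_symPackingOrbitope {p q : ℕ} {x : Tri p q → ℝ} (h : Checks p q (entry x))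
    (hqp : q ≤ p) : x ∈ symPackingOrbitope p q := by
  let L : (ℕ → ℕ → ℝ) × (ℕ → ℝ) →ₗ[ℝ] Tri p q → ℝ :=
    { toFun := fun v e => v.1 e.row e.col
      map_add' := fun _ _ => rfl
      map_smul' := fun _ _ => rfl }
  have hmem := Set.mem_image_of_mem L (h.mem_convexHull hqp le_rfl)
  rw [LinearMap.image_convexHull] at hmem
  have hx : L (fun a b => if a < p then entry x a b else 0,
      fun k => reach (entry x) q p k - reach (entry x) q p (k + 1)) = x := by
    funext e
    change (if e.row < p then entry x e.row e.col else 0) = x e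
    rw [if_pos e.row_lt, entry_row_col]
  rw [hx] at hmem
  rw [symPackingOrbitope_eq]
  refine convexHull_mono ?_ hmem
  rintro _ ⟨_, ⟨F, k, hF, -, -, -, rfl⟩, rfl⟩
  exact ⟨F, hF, rfl⟩

theorem symPackingOrbitope_eq_solutions {p q : ℕ} (hqp : q ≤ p) :
    symPackingOrbitope p q = solutions (packingSystem p q) :=
  (symPackingOrbitope_subset p q).antisymm fun _ hx =>
    (checks_of_mem_solutions hx).mem_symPackingOrbitope hqp

theorem Checks.mem_solutions {p q : ℕ} {x : Tri p q → ℝ} (h : Checks p q (entry x))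
    (hqp : q ≤ p) : x ∈ solutions (packingSystem p q) :=
  symPackingOrbitope_subset p q (h.mem_symPackingOrbitope hqp)


/-! ### Facets of full-dimensional sets -/

section Facets

variable {ι : Type} {P : Set (ι → ℝ)}

/-- The face of `P` in which the inequality `r` is tight. -/
def face (P : Set (ι → ℝ)) (r : LinIneq ι) : Set (ι → ℝ) := P ∩ {x | r.lhs x = r.rhs}

theorem sub_mem_vectorSpan {Q : Set (ι → ℝ)} {x y : ι → ℝ} (hx : x ∈ Q) (hy : y ∈ Q) :
    x - y ∈ vectorSpan ℝ Q :=
  vsub_mem_vectorSpan ℝ hx hy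

theorem vectorSpan_face_le_ker (P : Set (ι → ℝ)) (r : LinIneq ι) :
    vectorSpan ℝ (face P r) ≤ LinearMap.ker r.lhs := by
  rw [vectorSpan_def, Submodule.span_le]
  rintro _ ⟨x, hx, y, hy, rfl⟩
  have h1 : r.lhs x = r.rhs := hx.2
  have h2 : r.lhs y = r.rhs := hy.2
  simp [h1, h2]

theorem convex_face (hP : Convex ℝ P) (r : LinIneq ι) : Convex ℝ (face P r) := by
  refine hP.inter fun x hx y hy a b _ _ hab => ?_
  have h1 : r.lhs x = r.rhs := hx
  have h2 : r.lhs y = r.rhs := hy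
  change r.lhs (a • x + b • y) = r.rhs
  rw [map_add, map_smul, map_smul, h1, h2, ← add_smul, hab, one_smul]

theorem not_definesFacet_of_forall_eq {r : LinIneq ι} (h : ∀ x ∈ P, r.lhs x = r.rhs) :
    ¬ DefinesFacet P r := by
  rintro ⟨-, -, hd⟩
  rw [Set.inter_eq_left.2 fun x hx => Set.mem_ofPred_eq ▸ h x hx] at hd
  omega

theorem DefinesFacet.lhs_ne_zero {r : LinIneq ι} (h : DefinesFacet P r) : r.lhs ≠ 0 := by
  intro h0
  obtain ⟨z, -, hz⟩ := h.2.1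
  refine not_definesFacet_of_forall_eq (fun x _ => ?_) h
  rw [Set.mem_ofPred_eq, h0, LinearMap.zero_apply] at hz
  rw [h0, LinearMap.zero_apply, hz]

variable [Fintype ι]

theorem finrank_ker_add_one {f : (ι → ℝ) →ₗ[ℝ] ℝ} (hf : f ≠ 0) :
    Module.finrank ℝ (LinearMap.ker f) + 1 = Fintype.card ι := by
  have h := LinearMap.finrank_range_add_finrank_ker f
  rw [LinearMap.range_eq_top.2 (LinearMap.surjective hf), finrank_top, Module.finrank_self,
    Module.finrank_fintype_fun_eq_card] at h
  omega

theorem DefinesFacet.vectorSpan_eq {r : LinIneq ι} (h : DefinesFacet P r)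
    (hdim : polyDim P = Fintype.card ι) : vectorSpan ℝ (face P r) = LinearMap.ker r.lhs := by
  refine Submodule.eq_of_le_of_finrank_eq (vectorSpan_face_le_ker P r) ?_
  have h1 := h.2.2
  have h2 := finrank_ker_add_one h.lhs_ne_zero
  rw [hdim] at h1
  change Module.finrank ℝ (vectorSpan ℝ (face P r)) + 1 = _ at h1
  omega

variable [DecidableEq ι]

theorem polyDim_eq_card (h : ∀ e, Pi.single e 1 ∈ vectorSpan ℝ P) :
    polyDim P = Fintype.card ι := by
  have htop : vectorSpan ℝ P = ⊤ := by
    rw [eq_top_iff]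
    intro x _
    rw [← Finset.univ_sum_single x]
    refine Submodule.sum_mem _ fun e _ => ?_
    have : (Pi.single e (x e) : ι → ℝ) = x e • Pi.single e 1 := by
      rw [← Pi.single_smul, smul_eq_mul, mul_one]
    rw [this]
    exact Submodule.smul_mem _ _ (h e)
  rw [polyDim, htop, finrank_top, Module.finrank_fintype_fun_eq_card]

theorem eq_sum_smul_single (x : ι → ℝ) : x = ∑ e, x e • (Pi.single e 1 : ι → ℝ) := by
  conv_lhs => rw [← Finset.univ_sum_single x]
  refine Finset.sum_congr rfl fun e _ => ?_
  rw [← Pi.single_smul, smul_eq_mul, mul_one]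

/-- A valid inequality defines a facet if the direction space of its face contains the vectors
`1_e - (a_e / a_{e₀}) 1_{e₀}`, where `a` are the coefficients of the inequality, because these span
its kernel. -/
theorem definesFacet_of_single_mem (hdim : polyDim P = Fintype.card ι) {r : LinIneq ι}
    (hvalid : ∀ x ∈ P, r.lhs x ≤ r.rhs) (hne : (face P r).Nonempty) (e₀ : ι)
    (h₀ : r.lhs (Pi.single e₀ 1) ≠ 0)
    (h : ∀ e, (Pi.single e 1 - (r.lhs (Pi.single e 1) / r.lhs (Pi.single e₀ 1)) • Pi.single e₀ 1 :
      ι → ℝ) ∈ vectorSpan ℝ (face P r)) : DefinesFacet P r := by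
  refine ⟨hvalid, hne, ?_⟩
  have hker : vectorSpan ℝ (face P r) = LinearMap.ker r.lhs := by
    refine (vectorSpan_face_le_ker P r).antisymm fun x hx => ?_
    have hsum : ∑ e, x e * r.lhs (Pi.single e 1) = 0 := by
      rw [LinearMap.mem_ker, eq_sum_smul_single x, map_sum] at hx
      simpa only [map_smul, smul_eq_mul] using hx
    have hx' : x = ∑ e, x e • (Pi.single e 1 -
        (r.lhs (Pi.single e 1) / r.lhs (Pi.single e₀ 1)) • Pi.single e₀ 1 : ι → ℝ) := by
      simp only [smul_sub, Finset.sum_sub_distrib, smul_smul]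
      rw [← Finset.sum_smul, ← eq_sum_smul_single]
      simp only [← mul_div_assoc]
      rw [← Finset.sum_div, hsum, zero_div, zero_smul, sub_zero]
    rw [hx']
    exact Submodule.sum_mem _ fun e _ => Submodule.smul_mem _ _ (h e)
  rw [hdim]
  change Module.finrank ℝ (vectorSpan ℝ (face P r)) + 1 = _
  rw [hker]
  refine finrank_ker_add_one fun h0 => h₀ ?_
  rw [h0, LinearMap.zero_apply]

/-- Two different inequalities with coefficients `-1`, `0`, `1` define different facets. -/
theorem DefinesFacet.exists_lt {r r' : LinIneq ι} (hdim : polyDim P = Fintype.card ι)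
    (h : DefinesFacet P r) (h' : DefinesFacet P r')
    (hc : ∀ e, r.lhs (Pi.single e 1) ∈ ({-1, 0, 1} : Set ℝ))
    (hc' : ∀ e, r'.lhs (Pi.single e 1) ∈ ({-1, 0, 1} : Set ℝ)) (hne : r' ≠ r) :
    ∃ z ∈ face P r, r'.lhs z < r'.rhs := by
  by_contra hcon
  push Not at hcon
  have htight : ∀ z ∈ face P r, r'.lhs z = r'.rhs := fun z hz =>
    le_antisymm (h'.1 z hz.1) (hcon z hz)
  have hker : LinearMap.ker r.lhs ≤ LinearMap.ker r'.lhs := by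
    rw [← h.vectorSpan_eq hdim, vectorSpan_def, Submodule.span_le]
    rintro _ ⟨x, hx, y, hy, rfl⟩
    simp [htight x hx, htight y hy]
  obtain ⟨e, he⟩ : ∃ e, r.lhs (Pi.single e 1) ≠ 0 := by
    by_contra hall
    push Not at hall
    refine h.lhs_ne_zero (LinearMap.ext fun x => ?_)
    rw [eq_sum_smul_single x, map_sum]
    simp [hall]
  set a := r.lhs (Pi.single e 1) with ha
  set a' := r'.lhs (Pi.single e 1) with ha'
  have hprop : ∀ x, a * r'.lhs x = a' * r.lhs x := by
    intro x
    have hx : a • x - r.lhs x • Pi.single e 1 ∈ LinearMap.ker r.lhs := by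
      rw [LinearMap.mem_ker, map_sub, map_smul, map_smul, smul_eq_mul, smul_eq_mul, ← ha]
      ring
    have := hker hx
    rw [LinearMap.mem_ker, map_sub, map_smul, map_smul, smul_eq_mul, smul_eq_mul, ← ha'] at this
    linarith
  obtain ⟨z, hz⟩ := h.2.1
  have hz1 : r.lhs z = r.rhs := hz.2
  have hz2 : r'.lhs z = r'.rhs := htight z hz
  have ha0 : a' ≠ 0 := by
    intro h0
    refine h'.lhs_ne_zero (LinearMap.ext fun x => ?_)
    have := hprop x
    rw [h0, zero_mul] at this
    exact (mul_eq_zero.1 this).resolve_left he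
  have hsq : a = a' ∨ a = -a' := by
    rcases hc e with h1 | h1 | h1 <;> rcases hc' e with h2 | h2 | h2 <;>
      simp only [← ha, ← ha', Set.mem_singleton_iff] at h1 h2 <;>
      first
        | exact absurd h1 he
        | exact absurd h2 ha0
        | (rw [h1, h2]; norm_num)
  rcases hsq with heq | heq
  · have hlhs : r'.lhs = r.lhs := LinearMap.ext fun x => by
      have := hprop x
      rw [heq] at this
      exact mul_left_cancel₀ ha0 this
    apply hne
    have hrhs : r'.rhs = r.rhs := by rw [← hz1, ← hz2, hlhs]
    cases r; cases r'
    simp_all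
  · -- the two inequalities would be opposite, and `P` would lie in a hyperplane
    have hneg : ∀ x, r'.lhs x = - r.lhs x := fun x => by
      have := hprop x
      rw [heq] at this
      have h3 : a' * (r'.lhs x + r.lhs x) = 0 := by linarith
      linarith [(mul_eq_zero.1 h3).resolve_left ha0]
    refine not_definesFacet_of_forall_eq (fun x hx => le_antisymm (h.1 x hx) ?_) h
    have h4 := h'.1 x hx
    rw [hneg, ← hz2, hneg, hz1] at h4
    linarith

/-- A point of a facet that lies on no other facet can be moved across it, which violates only the
inequality of this facet. -/
theorem nonRedundant_of_facets {sys : Set (LinIneq ι)} (hfin : sys.Finite)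
    (hdim : polyDim (solutions sys) = Fintype.card ι)
    (hfacet : ∀ r ∈ sys, DefinesFacet (solutions sys) r)
    (hcoef : ∀ r ∈ sys, ∀ e, r.lhs (Pi.single e 1) ∈ ({-1, 0, 1} : Set ℝ)) :
    NonRedundant sys := by
  classical
  intro r hr
  refine ⟨fun x hx s hs => hx s hs.1, fun hsub => ?_⟩
  have hrf := hfacet r hr
  have hpt : ∀ T : Finset (LinIneq ι), (↑T ⊆ sys \ {r}) →
      ∃ z ∈ face (solutions sys) r, ∀ s ∈ T, s.lhs z < s.rhs := by
    intro T
    induction T using Finset.induction_on with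
    | empty =>
      intro _
      obtain ⟨z, hz⟩ := hrf.2.1
      exact ⟨z, hz, by simp⟩
    | insert s T _ ih =>
      intro hT
      rw [Finset.coe_insert, Set.insert_subset_iff] at hT
      obtain ⟨z, hz, hzT⟩ := ih hT.2
      obtain ⟨w, hw, hws⟩ := hrf.exists_lt hdim (hfacet s hT.1.1) (hcoef r hr)
        (hcoef s hT.1.1) hT.1.2
      refine ⟨(1 / 2 : ℝ) • z + (1 / 2 : ℝ) • w, convex_face (convex_solutions sys) r hz hw
        (by norm_num) (by norm_num) (by norm_num), fun t ht => ?_⟩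
      rw [map_add, map_smul, map_smul, smul_eq_mul, smul_eq_mul]
      rcases Finset.mem_insert.1 ht with rfl | ht
      · have := hz.1 t hT.1.1
        linarith
      · have h1 := hzT t ht
        have h2 := hw.1 t (hT.2 ht).1
        linarith
  have hfin' : (sys \ {r}).Finite := hfin.subset Set.sdiff_subset
  obtain ⟨z, hz, hzs⟩ := hpt hfin'.toFinset (by simp)
  obtain ⟨d, hd⟩ : ∃ d, 0 < r.lhs d := by
    obtain ⟨d, hd⟩ := LinearMap.surjective hrf.lhs_ne_zero 1
    exact ⟨d, by rw [hd]; exact zero_lt_one⟩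
  have hev : ∀ᶠ ε : ℝ in nhdsWithin 0 (Set.Ioi 0), ∀ s ∈ sys \ {r}, s.lhs (z + ε • d) < s.rhs := by
    rw [Filter.eventually_all_finite hfin']
    intro s hs
    have hcont : Continuous fun ε : ℝ => s.lhs (z + ε • d) := by
      simp only [map_add, map_smul, smul_eq_mul]
      fun_prop
    refine (hcont.continuousAt.eventually_lt continuousAt_const ?_).filter_mono nhdsWithin_le_nhds
    rw [zero_smul, add_zero]
    exact hzs s (hfin'.mem_toFinset.2 hs)
  obtain ⟨ε, hε, hpos⟩ := (hev.and self_mem_nhdsWithin).exists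
  have hviol := hsub (fun s hs => (hε s hs).le) r hr
  have hz1 : r.lhs z = r.rhs := hz.2
  rw [map_add, map_smul, smul_eq_mul, hz1] at hviol
  have := mul_pos (Set.mem_Ioi.1 hpos) hd
  linarith

end Facets


/-! ### The facets of the packing orbitope -/

section

variable {p q : ℕ}

theorem sumOver_single (S : Finset (Tri p q)) (e : Tri p q) :
    sumOver S (Pi.single e 1) = if e ∈ S then 1 else 0 := by
  rw [sumOver_apply, Finset.sum_pi_single']

theorem sumOver_vert_eq_zero {S : Finset (Tri p q)} {F : ℕ → ℕ → Prop}
    (h : ∀ e ∈ S, ¬ F e.row e.col) : sumOver S (vert p q F) = 0 := by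
  rw [sumOver_apply]
  exact Finset.sum_eq_zero fun e he => ind_of_not (h e he)

theorem sumOver_vert_eq_one {S : Finset (Tri p q)} {F : ℕ → ℕ → Prop} {i j : ℕ} (hi : i < p)
    (hj : j < q) (hji : j ≤ i) (hmem : ∀ e : Tri p q, e.row = i → e.col = j → e ∈ S) (hF : F i j)
    (h : ∀ e ∈ S, F e.row e.col → e.row = i ∧ e.col = j) : sumOver S (vert p q F) = 1 := by
  obtain ⟨e, rfl, rfl⟩ := Tri.exists_of_le hi hj hji
  rw [sumOver_apply, Finset.sum_eq_single_of_mem e (hmem e rfl rfl)]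
  · exact ind_of hF
  · intro f hf hfe
    refine ind_of_not fun hFf => hfe ?_
    obtain ⟨h1, h2⟩ := h f hf hFf
    exact Tri.eq_of_row_of_col h1 h2

theorem vert_insert {F : ℕ → ℕ → Prop} {e : Tri p q} (h : ¬ F e.row e.col) :
    vert p q (fun a b => F a b ∨ (a = e.row ∧ b = e.col)) - vert p q F = Pi.single e 1 := by
  funext f
  rw [Pi.sub_apply, vert, vert, ind_insert h, Pi.add_apply, Pi.add_apply, add_sub_cancel_left]
  by_cases hf : f = e
  · rw [hf, Pi.single_eq_same, ind_of ⟨rfl, rfl⟩]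
  · rw [Pi.single_eq_of_ne hf, ind_of_not]
    exact fun h => hf (Tri.eq_of_row_of_col h.1 h.2)

/-- The ladder that enters the column `b` in row `b + h b`, for `b < n`. -/
def path (h : ℕ → ℕ) (n : ℕ) : ℕ → ℕ → Prop := fun a b => b < n ∧ a = b + h b

theorem isLadder_path {h : ℕ → ℕ} (hh : Monotone h) (n : ℕ) : IsLadder (path h n) where
  row := by
    rintro i j k ⟨-, h1⟩ ⟨-, h2⟩
    rcases lt_trichotomy j k with hjk | rfl | hjk
    · have := hh hjk.le
      omega
    · rfl
    · have := hh hjk.le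
      omega
  start := by
    rintro i j ⟨h1, h2⟩
    have := hh (Nat.le_succ j)
    rw [Nat.succ_eq_add_one] at this
    exact ⟨j + h j, by omega, by omega, rfl⟩

theorem IsLadder.vert_mem_face {F : ℕ → ℕ → Prop} (hF : IsLadder F) {r : LinIneq (Tri p q)}
    (h : r.lhs (vert p q F) = r.rhs) : vert p q F ∈ face (symPackingOrbitope p q) r :=
  ⟨hF.vert_mem p q, h⟩

/-- A unit vector lies in the direction space of a face if its position can be added to a ladder in
the face without leaving the face. -/
theorem single_mem_of_insert {r : LinIneq (Tri p q)} {e : Tri p q}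
    (hr : r.lhs (Pi.single e 1) = 0) {F : ℕ → ℕ → Prop} (hF : IsLadder F)
    (hface : r.lhs (vert p q F) = r.rhs) (hrow : ∀ k, ¬ F e.row k)
    (hcol : ∀ k, e.col = k + 1 → ∃ i' < e.row, F i' k) :
    Pi.single e 1 ∈ vectorSpan ℝ (face (symPackingOrbitope p q) r) := by
  have heq := vert_insert (hrow e.col)
  rw [← heq]
  refine sub_mem_vectorSpan ((hF.insert hrow hcol).vert_mem_face ?_) (hF.vert_mem_face hface)
  rw [← hface, ← sub_eq_zero, ← map_sub, heq, hr]

theorem single_mem_vectorSpan (e : Tri p q) :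
    Pi.single e 1 ∈ vectorSpan ℝ (symPackingOrbitope p q) := by
  have := e.col_le_row
  have hF := isLadder_path (monotone_const (c := 0)) e.col
  have hrow : ∀ k, ¬ path (fun _ => 0) e.col e.row k := by
    rintro k ⟨h1, h2⟩
    beta_reduce at h2
    omega
  rw [← vert_insert (hrow e.col)]
  refine sub_mem_vectorSpan ((hF.insert hrow fun k hk => ⟨k, ?_, ?_, rfl⟩).vert_mem p q)
    (hF.vert_mem p q)
  · omega
  · omega

theorem polyDim_symPackingOrbitope (p q : ℕ) :
    polyDim (symPackingOrbitope p q) = Fintype.card (Tri p q) :=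
  polyDim_eq_card single_mem_vectorSpan

theorem valid_of_mem {r : LinIneq (Tri p q)} (hr : r ∈ packingSystem p q) :
    ∀ x ∈ symPackingOrbitope p q, r.lhs x ≤ r.rhs := fun _ hx =>
  symPackingOrbitope_subset p q hx r hr

theorem definesFacet_nonneg {i j : ℕ} (hi : i < p) (hj : j < q) (hji : j ≤ i)
    (hij : ¬ (i = j ∧ j + 1 < q)) :
    DefinesFacet (symPackingOrbitope p q) (nonnegIneq p q i j) := by
  obtain ⟨e₀, he1, he2⟩ := Tri.exists_of_le hi hj hji
  have hcoef : ∀ e, (nonnegIneq p q i j).lhs (Pi.single e 1) = if e = e₀ then -1 else 0 := by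
    intro e
    rw [nonnegIneq, LinearMap.neg_apply, sumOver_single]
    have : e ∈ ({e : Tri p q | e.row = i ∧ e.col = j} : Finset (Tri p q)) ↔ e = e₀ := by
      rw [Finset.mem_filter_univ]
      constructor
      · rintro ⟨h1, h2⟩
        exact Tri.eq_of_row_of_col (h1.trans he1.symm) (h2.trans he2.symm)
      · rintro rfl
        exact ⟨he1, he2⟩
    by_cases h : e = e₀
    · rw [if_pos (this.2 h), if_pos h]
    · rw [if_neg fun h' => h (this.1 h'), if_neg h, neg_zero]
  -- the main diagonal up to a column contains `(i, j)` only in the excluded case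
  have hface : ∀ n < q, (nonnegIneq p q i j).lhs (vert p q (path (fun _ => 0) n)) =
      (nonnegIneq p q i j).rhs := by
    intro n hn
    rw [nonnegIneq, LinearMap.neg_apply, sumOver_vert_eq_zero, neg_zero]
    intro e he
    rw [Finset.mem_filter_univ] at he
    rintro ⟨h1, h2⟩
    beta_reduce at h2
    omega
  have hF := fun n => isLadder_path (monotone_const (c := 0)) n
  refine definesFacet_of_single_mem (polyDim_symPackingOrbitope p q)
    (valid_of_mem (Or.inl (Or.inr ⟨i, j, hi, hj, hji, hij, rfl⟩)))
    ⟨_, (hF 0).vert_mem_face (hface 0 (by omega))⟩ e₀ (by simp [hcoef]) fun e => ?_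
  rw [hcoef, hcoef e₀, if_pos rfl]
  split_ifs with he
  · simp [he]
  · rw [zero_div, zero_smul, sub_zero]
    have := e.col_le_row
    refine single_mem_of_insert (by rw [hcoef, if_neg he]) (hF e.col) (hface _ e.col_lt) ?_ ?_
    · rintro k ⟨h1, h2⟩
      beta_reduce at h2
      omega
    · exact fun k hk => ⟨k, by omega, by omega, rfl⟩

theorem definesFacet_row {i : ℕ} (hi : i < p) (hq : 0 < q) :
    DefinesFacet (symPackingOrbitope p q) (rowIneq p q i) := by
  obtain ⟨e₀, he1, he2⟩ := Tri.exists_of_le hi hq (Nat.zero_le i)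
  have hcoef : ∀ e, (rowIneq p q i).lhs (Pi.single e 1) = if e.row = i then 1 else 0 := by
    intro e
    rw [rowIneq, sumOver_single]
    simp [rowSet]
  have hface : ∀ F, IsLadder F → (∃ b < q, F i b) →
      (rowIneq p q i).lhs (vert p q F) = (rowIneq p q i).rhs := by
    rintro F hF ⟨b, hb, hFb⟩
    rw [rowIneq]
    refine sumOver_vert_eq_one hi hb (hF.le hFb) ?_ hFb ?_
    · intro e h1 _
      simp [rowSet, h1]
    · intro e he hFe
      rw [rowSet, Finset.mem_filter_univ] at he
      exact ⟨he, hF.row (he ▸ hFe) hFb⟩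
  have hF := fun n => isLadder_path (monotone_const (c := 0)) n
  -- the main diagonal up to column `n`, with a `1` in row `i` added
  have hins : ∀ n b, n ≤ i → b ≤ n →
      IsLadder fun a c => path (fun _ => 0) n a c ∨ (a = i ∧ c = b) := by
    intro n b hn hb
    refine (hF n).insert ?_ ?_
    · rintro k ⟨h1, h2⟩
      beta_reduce at h2
      omega
    · exact fun k hk => ⟨k, by omega, by omega, rfl⟩
  refine definesFacet_of_single_mem (polyDim_symPackingOrbitope p q)
    (valid_of_mem (Or.inl (Or.inl ⟨i, hi, rfl⟩)))
    ⟨_, (hins 0 0 (by omega) le_rfl).vert_mem_face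
      (hface _ (hins 0 0 (by omega) le_rfl) ⟨0, hq, Or.inr ⟨rfl, rfl⟩⟩)⟩ e₀
    (by rw [hcoef, if_pos he1]; exact one_ne_zero) fun e => ?_
  have hle := e.col_le_row
  have hlt := e.col_lt
  rw [hcoef, hcoef e₀, if_pos he1]
  split_ifs with he
  · -- exchange the two positions of row `i`
    have hno : ∀ b, ¬ path (fun _ => 0) e.col i b := by
      rintro k ⟨h1, h2⟩
      beta_reduce at h2
      omega
    rw [div_one, one_smul,
      ← vert_insert (e := e) (F := path (fun _ => 0) e.col) (by rw [he]; exact hno _),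
      ← vert_insert (e := e₀) (F := path (fun _ => 0) e.col) (by rw [he1]; exact hno _),
      sub_sub_sub_cancel_right, he, he1, he2]
    have h1 := hins e.col e.col (by omega) le_rfl
    have h2 := hins e.col 0 (by omega) (Nat.zero_le _)
    exact sub_mem_vectorSpan (h1.vert_mem_face (hface _ h1 ⟨_, hlt, Or.inr ⟨rfl, rfl⟩⟩))
      (h2.vert_mem_face (hface _ h2 ⟨0, hq, Or.inr ⟨rfl, rfl⟩⟩))
  · rw [zero_div, zero_smul, sub_zero]
    have hr : (rowIneq p q i).lhs (Pi.single e 1) = 0 := by rw [hcoef, if_neg he]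
    by_cases hcol : e.col ≤ i
    · have h1 := hins e.col 0 hcol (Nat.zero_le _)
      refine single_mem_of_insert hr h1 (hface _ h1 ⟨0, hq, Or.inr ⟨rfl, rfl⟩⟩) ?_ ?_
      · rintro k (⟨h1, h2⟩ | ⟨h1, -⟩)
        · beta_reduce at h2
          omega
        · exact he h1
      · exact fun k hk => ⟨k, by omega, Or.inl ⟨by omega, rfl⟩⟩
    · refine single_mem_of_insert hr (hF e.col)
        (hface _ (hF e.col) ⟨i, by omega, by omega, rfl⟩) ?_ ?_
      · rintro k ⟨h1, h2⟩
        beta_reduce at h2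
        omega
      · exact fun k hk => ⟨k, by omega, by omega, rfl⟩

/-! ### Facets from shifted columns -/

theorem mem_bar {i j : ℕ} {e : Tri p q} : e ∈ bar p q i j ↔ e.row = i ∧ j ≤ e.col := by
  rw [bar, Finset.mem_filter_univ]

theorem mem_shiftedColumn {n : ℕ} {c : ℕ → ℕ} {e : Tri p q} :
    e ∈ shiftedColumn p q n c ↔ ∃ k < n, e.row = c k + k ∧ e.col = c k := by
  rw [shiftedColumn, Finset.mem_filter_univ]

theorem shiftedColumnIneq_vert_of_disjoint {i j : ℕ} {c : ℕ → ℕ} {F : ℕ → ℕ → Prop}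
    (hbar : ∀ b, j ≤ b → ¬ F i b) (hS : ∀ t ≤ i - j, ¬ F (c t + t) (c t)) :
    (shiftedColumnIneq p q i j c).lhs (vert p q F) = (shiftedColumnIneq p q i j c).rhs := by
  rw [shiftedColumnIneq, LinearMap.sub_apply, sumOver_vert_eq_zero, sumOver_vert_eq_zero, sub_zero]
  · intro e he
    obtain ⟨k, hk, h1, h2⟩ := mem_shiftedColumn.1 he
    rw [h1, h2]
    exact hS k (by omega)
  · intro e he
    obtain ⟨h1, h2⟩ := mem_bar.1 he
    rw [h1]
    exact hbar _ h2

theorem shiftedColumnIneq_vert_of_meets {i j : ℕ} {c : ℕ → ℕ} (hc : IsReducedShift p q i j c)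
    {F : ℕ → ℕ → Prop} (hF : IsLadder F) {b t : ℕ} (hb : j ≤ b) (hbq : b < q) (hFb : F i b)
    (ht : t ≤ i - j) (hFt : F (c t + t) (c t))
    (huniq : ∀ s ≤ i - j, F (c s + s) (c s) → s = t) :
    (shiftedColumnIneq p q i j c).lhs (vert p q F) = (shiftedColumnIneq p q i j c).rhs := by
  obtain ⟨hi, hj, h1j, hji, hmono, hlast, -, -⟩ := hc
  have hct := hmono t (i - j) ht le_rfl
  rw [shiftedColumnIneq, LinearMap.sub_apply,
    sumOver_vert_eq_one hi hbq (hF.le hFb) (fun e h1 h2 => mem_bar.2 ⟨h1, by omega⟩) hFb,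
    sumOver_vert_eq_one (i := c t + t) (j := c t) (by omega) (by omega) (by omega)
      (fun e h1 h2 => mem_shiftedColumn.2 ⟨t, by omega, h1, h2⟩) hFt, sub_self]
  · intro e he hFe
    obtain ⟨k, hk, h1, h2⟩ := mem_shiftedColumn.1 he
    rw [h1, h2] at hFe
    obtain rfl := huniq k (by omega) hFe
    exact ⟨h1, h2⟩
  · intro e he hFe
    obtain ⟨h1, h2⟩ := mem_bar.1 he
    exact ⟨h1, hF.row (h1 ▸ hFe) hFb⟩

theorem single_add_single_mem {ι : Type} [Fintype ι] [DecidableEq ι] {W : Submodule ℝ (ι → ℝ)}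
    {v : ι → ℝ} (hv : v ∈ W) {e f : ι} (hef : e ≠ f) (he : v e = 1) (hf : v f = 1)
    (h : ∀ g, g ≠ e → g ≠ f → v g ≠ 0 → Pi.single g 1 ∈ W) :
    (Pi.single e 1 + Pi.single f 1 : ι → ℝ) ∈ W := by
  have h1 : v - ∑ g ∈ ({e, f} : Finset ι)ᶜ, v g • (Pi.single g 1 : ι → ℝ) =
      Pi.single e 1 + Pi.single f 1 := by
    rw [sub_eq_iff_eq_add]
    conv_lhs => rw [eq_sum_smul_single v]
    rw [← Finset.sum_add_sum_compl {e, f}, Finset.sum_pair hef, he, hf, one_smul, one_smul]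
  rw [← h1]
  refine W.sub_mem hv (W.sum_mem fun g hg => ?_)
  simp only [Finset.mem_compl, Finset.mem_insert, Finset.mem_singleton, not_or] at hg
  by_cases h0 : v g = 0
  · rw [h0, zero_smul]
    exact W.zero_mem
  · exact W.smul_mem _ (h g hg.1 hg.2 h0)

/-- Away from the bar and the shifted column, every unit vector is a direction of the face: there
is a ladder in the face that avoids the row of the position and has entered the column to the left
of it. It either avoids both the bar and the shifted column, or it meets both exactly once; for a
position between the two it changes the diagonal to skip the row. -/
theorem single_mem_of_off {i j : ℕ} {c : ℕ → ℕ} (hc : IsReducedShift p q i j c) {e : Tri p q}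
    (he : e ∉ bar p q i j) (heS : e ∉ shiftedColumn p q (i - j + 1) c) :
    Pi.single e 1 ∈ vectorSpan ℝ (face (symPackingOrbitope p q) (shiftedColumnIneq p q i j c)) := by
  have hr : (shiftedColumnIneq p q i j c).lhs (Pi.single e 1) = 0 := by
    rw [shiftedColumnIneq, LinearMap.sub_apply, sumOver_single, sumOver_single, if_neg he,
      if_neg heS, sub_zero]
  have hc' := hc
  obtain ⟨hi, hj, h1j, hji, hmono, hlast, htwo, hone⟩ := hc
  rw [mem_bar] at he
  rw [mem_shiftedColumn] at heS
  push Not at heS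
  have hlt := e.col_lt
  obtain ⟨δ, hδ⟩ : ∃ δ, e.row = e.col + δ := ⟨e.row - e.col, by have := e.col_le_row; omega⟩
  have hcd : ∀ t ≤ i - j, c t < j := fun t ht => (hmono t _ ht le_rfl).trans_lt hlast
  have hF := isLadder_path (monotone_const (c := δ)) e.col
  have hFrow : ∀ k, ¬ path (fun _ => δ) e.col e.row k := by
    rintro k ⟨h1, h2⟩
    beta_reduce at h2
    omega
  have hFcol : ∀ k, e.col = k + 1 → ∃ i' < e.row, path (fun _ => δ) e.col i' k := fun k hk =>
    ⟨k + δ, by omega, by omega, rfl⟩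
  by_cases hbefore : i - j < δ ∨ e.col ≤ c δ
  · refine single_mem_of_insert hr hF (shiftedColumnIneq_vert_of_disjoint ?_ ?_) hFrow hFcol
    · rintro b hb ⟨h1, h2⟩
      beta_reduce at h2
      rcases hbefore with h | h
      · omega
      · have := hcd δ (by omega)
        omega
    · rintro t ht ⟨h1, h2⟩
      beta_reduce at h2
      obtain rfl : t = δ := by omega
      omega
  push Not at hbefore
  obtain ⟨hδd, hcδ⟩ := hbefore
  have hi' : e.row ≠ i := fun h => he ⟨h, by omega⟩
  rcases lt_or_gt_of_ne hi' with hrow | hrow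
  · -- a `1` at `(i, j)` is added to a ladder `G` within the rows before `i`
    have key : ∀ G, IsLadder G → (∀ a b, G a b → a < i) → (∃ a < i, G a (j - 1)) →
        (∀ k, ¬ G e.row k) → (∀ k, e.col = k + 1 → ∃ i' < e.row, G i' k) → ∀ t ≤ i - j,
        G (c t + t) (c t) → (∀ s ≤ i - j, G (c s + s) (c s) → s = t) →
        Pi.single e 1 ∈
          vectorSpan ℝ (face (symPackingOrbitope p q) (shiftedColumnIneq p q i j c)) := by
      intro G hG hGi hGj hGrow hGcol t ht hGt huniq
      have hG' := hG.insert (i := i) (j := j) (fun k hk => lt_irrefl _ (hGi _ _ hk))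
        (fun k hk => by rwa [show k = j - 1 by omega])
      refine single_mem_of_insert hr hG' (shiftedColumnIneq_vert_of_meets hc' hG' le_rfl hj
        (Or.inr ⟨rfl, rfl⟩) ht (Or.inl hGt) ?_) ?_ ?_
      · rintro s hs (h | ⟨h1, h2⟩)
        · exact huniq s hs h
        · have := hcd s hs
          omega
      · rintro k (h | ⟨h, -⟩)
        · exact hGrow k h
        · exact hi' h
      · intro k hk
        obtain ⟨a, ha, h⟩ := hGcol k hk
        exact ⟨a, ha, Or.inl h⟩
    by_cases hcol : j ≤ e.col
    · refine key _ hF ?_ ?_ hFrow hFcol δ hδd ⟨hcδ, rfl⟩ ?_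
      · rintro a b ⟨h1, h2⟩
        beta_reduce at h2
        omega
      · exact ⟨j - 1 + δ, by omega, by omega, rfl⟩
      · rintro s hs ⟨h1, h2⟩
        beta_reduce at h2
        omega
    · rcases δ with _ | δ
      · -- here `c 0 = c 1` keeps the ladder from meeting the shifted column again
        have hij : j < i := by
          by_contra h
          have := hone (by omega)
          omega
        have h01 := htwo hij
        have hm : Monotone fun b => if b < e.col then 0 else 1 := by
          intro a b hab
          dsimp only
          split_ifs <;> omega
        refine key _ (isLadder_path hm j) ?_ ?_ ?_ ?_ 0 (Nat.zero_le _) ?_ ?_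
        · rintro a b ⟨h1, h2⟩
          beta_reduce at h2
          split_ifs at h2 <;> omega
        · refine ⟨_, ?_, by omega, rfl⟩
          beta_reduce
          split_ifs <;> omega
        · rintro k ⟨h1, h2⟩
          beta_reduce at h2
          split_ifs at h2 <;> omega
        · refine fun k hk => ⟨_, ?_, by omega, rfl⟩
          beta_reduce
          split_ifs <;> omega
        · refine ⟨by omega, ?_⟩
          beta_reduce
          rw [if_pos hcδ]
        · rintro s hs ⟨h1, h2⟩
          beta_reduce at h2
          split_ifs at h2 with h3
          · omega
          · obtain rfl : s = 1 := by omega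
            omega
      · have hprev := hmono δ (δ + 1) (Nat.le_succ δ) hδd
        have hm : Monotone fun b => if b ≤ e.col then δ else δ + 1 := by
          intro a b hab
          dsimp only
          split_ifs <;> omega
        refine key _ (isLadder_path hm j) ?_ ?_ ?_ ?_ δ (by omega) ?_ ?_
        · rintro a b ⟨h1, h2⟩
          beta_reduce at h2
          split_ifs at h2 <;> omega
        · refine ⟨_, ?_, by omega, rfl⟩
          beta_reduce
          split_ifs <;> omega
        · rintro k ⟨h1, h2⟩
          beta_reduce at h2
          split_ifs at h2 <;> omega
        · refine fun k hk => ⟨_, ?_, by omega, rfl⟩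
          beta_reduce
          split_ifs <;> omega
        · refine ⟨by omega, ?_⟩
          beta_reduce
          rw [if_pos (by omega)]
        · rintro s hs ⟨h1, h2⟩
          beta_reduce at h2
          split_ifs at h2 with h3
          · omega
          · obtain rfl : s = δ + 1 := by omega
            omega
  · -- the diagonal of the position meets row `i` within the bar
    refine single_mem_of_insert hr hF (shiftedColumnIneq_vert_of_meets hc' hF (b := i - δ) (t := δ)
      (by omega) (by omega) ⟨by omega, by beta_reduce; omega⟩ hδd ⟨hcδ, rfl⟩ ?_) hFrow hFcol
    rintro s hs ⟨h1, h2⟩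
    beta_reduce at h2
    omega

/-- If `e` lies in the bar and `f` in the shifted column, and the diagonal of `f` reaches the column
of `e` by the row of the bar, then the sum of the two unit vectors is a direction of the face: going
down the diagonal of `f` and then to `e` gives a ladder in the face that meets the bar only in `e`
and the shifted column only in `f`. -/
theorem single_add_single_mem_of_meets {i j : ℕ} {c : ℕ → ℕ} (hc : IsReducedShift p q i j c)
    {t b : ℕ} (ht : t ≤ i - j) (hb : j ≤ b) (hbt : b + t ≤ i) {e f : Tri p q} (he1 : e.row = i)
    (he2 : e.col = b) (hf1 : f.row = c t + t) (hf2 : f.col = c t) :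
    (Pi.single e 1 + Pi.single f 1 : Tri p q → ℝ) ∈
      vectorSpan ℝ (face (symPackingOrbitope p q) (shiftedColumnIneq p q i j c)) := by
  have hc' := hc
  obtain ⟨hi, hj, h1j, hji, hmono, hlast, -, -⟩ := hc
  have hcd : ∀ t ≤ i - j, c t < j := fun t ht => (hmono t _ ht le_rfl).trans_lt hlast
  have hct := hcd t ht
  have hF : IsLadder fun x y => path (fun _ => t) b x y ∨ (x = i ∧ y = b) := by
    refine (isLadder_path (monotone_const (c := t)) b).insert ?_ ?_
    · rintro k ⟨h1, h2⟩
      beta_reduce at h2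
      omega
    · exact fun k hk => ⟨k + t, by omega, by omega, rfl⟩
  have hzero : vert p q (fun _ _ => False) = 0 := by
    funext e
    exact ind_of_not id
  have hv : vert p q (fun x y => path (fun _ => t) b x y ∨ (x = i ∧ y = b)) ∈
      vectorSpan ℝ (face (symPackingOrbitope p q) (shiftedColumnIneq p q i j c)) := by
    have := sub_mem_vectorSpan (hF.vert_mem_face (r := shiftedColumnIneq p q i j c)
      (shiftedColumnIneq_vert_of_meets hc' hF hb (by rw [← he2]; exact e.col_lt)
        (Or.inr ⟨rfl, rfl⟩) ht (Or.inl ⟨by omega, rfl⟩) ?_))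
      (isLadder_empty.vert_mem_face (p := p) (q := q)
        (shiftedColumnIneq_vert_of_disjoint (fun _ _ => id) (fun _ _ => id)))
    · rwa [hzero, sub_zero] at this
    · rintro s hs (⟨h1, h2⟩ | ⟨h1, h2⟩)
      · beta_reduce at h2
        omega
      · have := hcd s hs
        omega
  refine single_add_single_mem hv ?_ ?_ ?_ ?_
  · rintro rfl
    omega
  · exact ind_of (Or.inr ⟨he1, he2⟩)
  · exact ind_of (Or.inl ⟨by omega, by beta_reduce; omega⟩)
  · intro g hge hgf hg
    have hFg : path (fun _ => t) b g.row g.col := by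
      by_contra h
      refine hg (ind_of_not ?_)
      rintro (h' | ⟨h1, h2⟩)
      · exact h h'
      · exact hge (Tri.eq_of_row_of_col (h1.trans he1.symm) (h2.trans he2.symm))
    obtain ⟨h1, h2⟩ := hFg
    beta_reduce at h2
    refine single_mem_of_off hc' ?_ ?_
    · rw [mem_bar]
      omega
    · rw [mem_shiftedColumn]
      rintro ⟨k, hk, h3, h4⟩
      obtain rfl : k = t := by omega
      exact hgf (Tri.eq_of_row_of_col (by omega) (by omega))

theorem definesFacet_shiftedColumn {i j : ℕ} {c : ℕ → ℕ} (hc : IsReducedShift p q i j c) :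
    DefinesFacet (symPackingOrbitope p q) (shiftedColumnIneq p q i j c) := by
  have hc' := hc
  obtain ⟨hi, hj, h1j, hji, hmono, hlast, -, -⟩ := hc
  have hcd : ∀ t ≤ i - j, c t < j := fun t ht => (hmono t _ ht le_rfl).trans_lt hlast
  obtain ⟨e₀, he1, he2⟩ := Tri.exists_of_le hi hj hji
  have hcoef : ∀ e, (shiftedColumnIneq p q i j c).lhs (Pi.single e 1) =
      (if e ∈ bar p q i j then 1 else 0) -
        (if e ∈ shiftedColumn p q (i - j + 1) c then 1 else 0) := fun e => by
    rw [shiftedColumnIneq, LinearMap.sub_apply, sumOver_single, sumOver_single]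
  have hdisj : ∀ e : Tri p q, e ∈ bar p q i j → e ∉ shiftedColumn p q (i - j + 1) c := by
    intro e he heS
    obtain ⟨k, hk, -, h2⟩ := mem_shiftedColumn.1 heS
    have := hcd k (by omega)
    have := (mem_bar.1 he).2
    omega
  have he₀ : e₀ ∈ bar p q i j := mem_bar.2 ⟨he1, he2.ge⟩
  have hcoef₀ : (shiftedColumnIneq p q i j c).lhs (Pi.single e₀ 1) = 1 := by
    rw [hcoef, if_pos he₀, if_neg (hdisj _ he₀), sub_zero]
  refine definesFacet_of_single_mem (polyDim_symPackingOrbitope p q)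
    (valid_of_mem (Or.inr ⟨i, j, c, hc', rfl⟩))
    ⟨_, isLadder_empty.vert_mem_face
      (shiftedColumnIneq_vert_of_disjoint (fun _ _ => id) (fun _ _ => id))⟩ e₀
    (by rw [hcoef₀]; exact one_ne_zero) fun e => ?_
  rw [hcoef₀, div_one, hcoef]
  by_cases heB : e ∈ bar p q i j
  · rw [if_pos heB, if_neg (hdisj e heB), sub_zero, one_smul]
    obtain ⟨h1, h2⟩ := mem_bar.1 heB
    have hle := e.col_le_row
    have hc0 := hcd 0 (Nat.zero_le _)
    obtain ⟨f, hf1, hf2⟩ :=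
      Tri.exists_of_le (p := p) (q := q) (i := c 0 + 0) (j := c 0) (by omega) (by omega) (by omega)
    have hA := single_add_single_mem_of_meets hc' (Nat.zero_le _) h2 (by omega) h1 rfl hf1 hf2
    have hB := single_add_single_mem_of_meets hc' (Nat.zero_le _) le_rfl (by omega) he1 he2 hf1 hf2
    have := Submodule.sub_mem _ hA hB
    rwa [add_sub_add_right_eq_sub] at this
  · rw [if_neg heB, zero_sub]
    by_cases heS : e ∈ shiftedColumn p q (i - j + 1) c
    · rw [if_pos heS, neg_smul, one_smul, sub_neg_eq_add, add_comm]
      obtain ⟨t, ht, h1, h2⟩ := mem_shiftedColumn.1 heS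
      exact single_add_single_mem_of_meets hc' (t := t) (by omega) le_rfl (by omega) he1 he2 h1 h2
    · rw [if_neg heS, neg_zero, zero_smul, sub_zero]
      exact single_mem_of_off hc' heB heS

theorem definesFacet_of_mem (hq : 0 < q) {r : LinIneq (Tri p q)} (hr : r ∈ packingSystem p q) :
    DefinesFacet (symPackingOrbitope p q) r := by
  rcases hr with (⟨i, hi, rfl⟩ | ⟨i, j, hi, hj, hji, hij, rfl⟩) | ⟨i, j, c, hc, rfl⟩
  · exact definesFacet_row hi hq
  · exact definesFacet_nonneg hi hj hji hij
  · exact definesFacet_shiftedColumn hc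

theorem finite_packingSystem (p q : ℕ) : (packingSystem p q).Finite := by
  refine Set.Finite.union (Set.Finite.union ?_ ?_) ?_
  · refine (Set.finite_range fun S : Finset (Tri p q) =>
      (⟨sumOver S, 1⟩ : LinIneq (Tri p q))).subset ?_
    rintro _ ⟨i, -, rfl⟩
    exact ⟨_, rfl⟩
  · refine (Set.finite_range fun S : Finset (Tri p q) =>
      (⟨-sumOver S, 0⟩ : LinIneq (Tri p q))).subset ?_
    rintro _ ⟨i, j, -, -, -, -, rfl⟩
    exact ⟨_, rfl⟩
  · refine (Set.finite_range fun S : Finset (Tri p q) × Finset (Tri p q) =>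
      (⟨sumOver S.1 - sumOver S.2, 0⟩ : LinIneq (Tri p q))).subset ?_
    rintro _ ⟨i, j, c, -, rfl⟩
    exact ⟨(_, _), rfl⟩

theorem coeff_mem {r : LinIneq (Tri p q)} (hr : r ∈ packingSystem p q) (e : Tri p q) :
    r.lhs (Pi.single e 1) ∈ ({-1, 0, 1} : Set ℝ) := by
  rcases hr with (⟨i, hi, rfl⟩ | ⟨i, j, hi, hj, hji, hij, rfl⟩) | ⟨i, j, c, hc, rfl⟩
  · rw [rowIneq, sumOver_single]
    split_ifs <;> simp
  · rw [nonnegIneq, LinearMap.neg_apply, sumOver_single]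
    split_ifs <;> simp
  · rw [shiftedColumnIneq, LinearMap.sub_apply, sumOver_single, sumOver_single]
    split_ifs <;> simp

theorem nonRedundant_packingSystem (hq : 0 < q) (hqp : q ≤ p) :
    NonRedundant (packingSystem p q) := by
  have hP := symPackingOrbitope_eq_solutions hqp
  refine nonRedundant_of_facets (finite_packingSystem p q) ?_ ?_ fun r hr e => coeff_mem hr e
  · rw [← hP]
    exact polyDim_symPackingOrbitope p q
  · intro r hr
    rw [← hP]
    exact definesFacet_of_mem hq hr

end


/-! ### Running programs -/

namespace Prog

open Classical in
/-- The final memory of a program without loops. -/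
noncomputable def eval : Prog → State → State
  | .instr c, s => c.run s
  | .seq P Q, s => Q.eval (P.eval s)
  | .ite b P Q, s => if b.Holds s then P.eval s else Q.eval s
  | .while _ _, s => s

/-- The program has no loops. -/
def LoopFree : Prog → Prop
  | .instr _ => True
  | .seq P Q => P.LoopFree ∧ Q.LoopFree
  | .ite _ P Q => P.LoopFree ∧ Q.LoopFree
  | .while _ _ => False

/-- The number of instructions and tests. -/
def size : Prog → ℕ
  | .instr _ => 1
  | .seq P Q => P.size + Q.size
  | .ite _ P Q => P.size + Q.size + 1
  | .while _ P => P.size + 1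

/-- A sequence of instructions. -/
def block : List Instr → Prog
  | [] => .instr .nop
  | c :: l => .seq (.instr c) (block l)

theorem eval_block (l : List Instr) (s : State) :
    (block l).eval s = l.foldl (fun s c => c.run s) s := by
  induction l generalizing s with
  | nil => rfl
  | cons c l ih => exact ih (c.run s)

theorem loopFree_block (l : List Instr) : (block l).LoopFree := by
  induction l with
  | nil => trivial
  | cons c l ih => exact ⟨trivial, ih⟩

theorem LoopFree.exists_exec {P : Prog} (hP : P.LoopFree) (s : State) :
    ∃ t ≤ P.size, Exec P s (P.eval s) t := by
  induction P generalizing s with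
  | instr c => exact ⟨1, le_rfl, .instr c s⟩
  | seq P Q ihP ihQ =>
    obtain ⟨t₁, h₁, e₁⟩ := ihP hP.1 s
    obtain ⟨t₂, h₂, e₂⟩ := ihQ hP.2 (P.eval s)
    exact ⟨t₁ + t₂, by rw [size]; omega, .seq e₁ e₂⟩
  | ite b P Q ihP ihQ =>
    by_cases hb : b.Holds s
    · obtain ⟨t, h, e⟩ := ihP hP.1 s
      refine ⟨t + 1, by rw [size]; omega, ?_⟩
      rw [eval, if_pos hb]
      exact .ite_true hb e
    · obtain ⟨t, h, e⟩ := ihQ hP.2 s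
      refine ⟨t + 1, by rw [size]; omega, ?_⟩
      rw [eval, if_neg hb]
      exact .ite_false hb e
  | _ => exact hP.elim

end Prog

/-- Started in `s`, the program halts after at most `T` steps, in a state that satisfies `post`. -/
def Runs (P : Prog) (s : State) (T : ℕ) (post : State → Prop) : Prop :=
  ∃ s' t, Exec P s s' t ∧ t ≤ T ∧ post s'

theorem Prog.LoopFree.runs {P : Prog} (hP : P.LoopFree) {s : State} {post : State → Prop}
    (h : post (P.eval s)) : Runs P s P.size post := by
  obtain ⟨t, ht, e⟩ := hP.exists_exec s
  exact ⟨_, t, e, ht, h⟩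

theorem Runs.seq {P Q : Prog} {s : State} {T₁ T₂ : ℕ} {mid post : State → Prop}
    (h₁ : Runs P s T₁ mid) (h₂ : ∀ s', mid s' → Runs Q s' T₂ post) :
    Runs (.seq P Q) s (T₁ + T₂) post := by
  obtain ⟨s₁, t₁, e₁, ht₁, hm⟩ := h₁
  obtain ⟨s₂, t₂, e₂, ht₂, hp⟩ := h₂ s₁ hm
  exact ⟨s₂, t₁ + t₂, .seq e₁ e₂, by omega, hp⟩

theorem Runs.ite {b : Test} {P Q : Prog} {s : State} {T : ℕ} {post : State → Prop}
    (h₁ : b.Holds s → Runs P s T post) (h₂ : ¬ b.Holds s → Runs Q s T post) :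
    Runs (.ite b P Q) s (T + 1) post := by
  by_cases hb : b.Holds s
  · obtain ⟨s', t, e, ht, hp⟩ := h₁ hb
    exact ⟨s', t + 1, .ite_true hb e, by omega, hp⟩
  · obtain ⟨s', t, e, ht, hp⟩ := h₂ hb
    exact ⟨s', t + 1, .ite_false hb e, by omega, hp⟩

theorem Runs.mono {P : Prog} {s : State} {T T' : ℕ} {post post' : State → Prop}
    (h : Runs P s T post) (hT : T ≤ T') (hpost : ∀ s', post s' → post' s') :
    Runs P s T' post' := by
  obtain ⟨s', t, e, ht, hp⟩ := h
  exact ⟨s', t, e, by omega, hpost _ hp⟩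

/-- A loop whose invariant carries a bound `n` on the number of remaining rounds. -/
theorem Runs.loop {b : Test} {P : Prog} {T : ℕ} (inv : ℕ → State → Prop)
    (h : ∀ n s, inv n s → b.Holds s → ∃ n', n = n' + 1 ∧ Runs P s T (inv n')) {n : ℕ} {s : State}
    (hs : inv n s) :
    Runs (.while b P) s (n * (T + 1) + 1) fun s' => ∃ n', inv n' s' ∧ ¬ b.Holds s' := by
  induction n generalizing s with
  | zero =>
    have hb : ¬ b.Holds s := fun hb => by
      obtain ⟨n', hn', -⟩ := h 0 s hs hb
      omega
    exact ⟨s, 1, .while_false hb, by omega, 0, hs, hb⟩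
  | succ n ih =>
    by_cases hb : b.Holds s
    · obtain ⟨n', hn', s₁, t₁, e₁, ht₁, h₁⟩ := h (n + 1) s hs hb
      obtain rfl : n = n' := by omega
      obtain ⟨s₂, t₂, e₂, ht₂, h₂⟩ := ih h₁
      refine ⟨s₂, t₁ + t₂ + 1, .while_true hb e₁ e₂, ?_, h₂⟩
      rw [Nat.succ_mul]
      omega
    · exact ⟨s, 1, .while_false hb, by omega, n + 1, hs, hb⟩

/-! ### The separation program -/

/-! Integer registers: `0` and `1` hold `p` and `q`, `2` and `3` the current row `i` and column `j`,
`4` the address `i * q + j`, `14` the address `i * q`, `15` the number `j + 1`, `9` and `13`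
addresses of neighbours; `5` to `8` hold the kind of the last violated constraint found, its row,
its column and its address; `10`, `11` and `12` hold the constants `1`, `0` and `2`; `16` holds the
number of the current diagonal while a shifted column is traced back. Rational registers: `0` holds
the entry, `1` the sum over the bar, `2` the weight of the lightest shifted column at `(i, j)`, `3`
the weight at `(i - 1, j - 1)`; `4` and `5` hold the constants `1` and `0`. The rational array `1`
holds the weights of the lightest shifted columns. -/

/-- Keep the current position as that of a violated constraint. -/
def recordProg (kind : ℕ) : Prog :=
  .block [.natConst 5 kind, .natAdd 6 2 11, .natAdd 7 3 11, .natAdd 8 4 11]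

/-- Go to the next column to the left, and load what is needed there. -/
def loadProg : Prog :=
  .block [.natSub 3 3 10, .natAdd 4 14 3, .natAdd 15 3 10, .ratLoad 0 0 4, .ratAdd 1 1 0,
    .natSub 9 4 1, .ratLoad 2 1 9, .ratAdd 2 2 0, .natSub 9 9 10, .ratLoad 3 1 9]

/-- Compute and store the weight of the lightest shifted column. -/
def tableProg : Prog :=
  .seq (.ite (.natLT 3 2)
    (.ite (.natLT 11 3) (.ite (.ratLT 3 2) (.instr (.ratAdd 2 3 5)) (.instr .nop)) (.instr .nop))
    (.instr (.ratAdd 2 0 5))) (.instr (.ratStore 1 4 2))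

/-- Check the nonnegativity constraint. -/
def signProg : Prog :=
  .ite (.ratLT 0 5)
    (.ite (.natLT 3 2) (recordProg 2) (.ite (.natLT 15 1) (.instr .nop) (recordProg 2)))
    (.instr .nop)

/-- Check the bar against the lightest shifted column or, in the first column, against `1`. -/
def barProg : Prog :=
  .ite (.natLT 11 3) (.ite (.ratLT 3 1) (recordProg 3) (.instr .nop))
    (.ite (.ratLT 4 1) (recordProg 1) (.instr .nop))

/-- Process the next position. -/
def cellProg : Prog :=
  .seq loadProg (.ite (.natLT 2 3) (.instr .nop) (.seq tableProg (.seq signProg barProg)))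

/-- Process a row from right to left. -/
def rowProg : Prog :=
  .seq (.block [.ratConst 1 0, .natAdd 3 1 11])
    (.seq (.while (.natLT 11 3) cellProg) (.block [.natAdd 14 14 1, .natAdd 2 2 10]))

/-- One step of tracing back a lightest shifted column. -/
def traceStep : Prog :=
  .seq (.block [.ratLoad 0 0 4, .natSub 9 4 1, .ratLoad 2 1 9, .ratAdd 2 2 0, .natSub 13 9 10,
      .ratLoad 3 1 13])
    (.ite (.natLT 11 3)
      (.ite (.ratLT 3 2) (.block [.natAdd 4 13 11, .natSub 3 3 10])
        (.block [.natStore 0 16 3, .natAdd 4 9 11, .natSub 16 16 10]))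
      (.block [.natStore 0 16 3, .natAdd 4 9 11, .natSub 16 16 10]))

/-- Trace back a lightest shifted column. -/
def traceProg : Prog :=
  .seq (.block [.natSub 3 7 10, .natSub 4 8 1, .natSub 4 4 10, .natSub 16 6 7])
    (.seq (.while (.natLT 11 16) traceStep) (.instr (.natStore 0 11 3)))

/-- The separation program. -/
def separationProg : Prog :=
  .seq (.block [.natConst 10 1, .natConst 12 2, .ratConst 4 1])
    (.seq (.while (.natLT 2 0) rowProg)
      (.seq (.ite (.natLT 12 5) traceProg (.instr .nop))
        (.block [.natAdd 0 5 11, .natAdd 1 6 11, .natAdd 2 7 11])))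

/-! ### Processing the positions -/

section

variable {p q : ℕ} {x : Tri p q → ℚ}

/-- Position `(m, k)` is processed before position `(i, j)`, or is this position. -/
def Before (i j m k : ℕ) : Prop := m < i ∨ (m = i ∧ j ≤ k)

/-- The constraints that are checked at `(i, j)`. -/
def CellOK (x : Tri p q → ℚ) (i j : ℕ) : Prop :=
  (¬ (i = j ∧ j + 1 < q) → 0 ≤ entry x i j) ∧
    (j = 0 → ∑ k ∈ Ico j q, entry x i k ≤ 1) ∧
    (1 ≤ j → ∑ k ∈ Ico j q, entry x i k ≤ lightest (entry x) (i - 1) (j - 1))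

/-- The constraint of the given kind at `(i, j)` is violated. -/
def Violated (x : Tri p q → ℚ) (kind i j : ℕ) : Prop :=
  (kind = 1 ∧ i < p ∧ 1 < ∑ k ∈ Ico 0 q, entry x i k) ∨
    (kind = 2 ∧ i < p ∧ j < q ∧ j ≤ i ∧ ¬ (i = j ∧ j + 1 < q) ∧ entry x i j < 0) ∨
    (kind = 3 ∧ i < p ∧ j < q ∧ 1 ≤ j ∧ j ≤ i ∧
      lightest (entry x) (i - 1) (j - 1) < ∑ k ∈ Ico j q, entry x i k)

/-- Either no violated constraint has been recorded, and `A` holds, or the record is correct. -/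
def Recorded (x : Tri p q → ℚ) (A : Prop) (s : State) : Prop :=
  (s.reg 5 = 0 ∧ A) ∨
    (Violated x (s.reg 5) (s.reg 6) (s.reg 7) ∧ s.reg 8 = s.reg 6 * q + s.reg 7)

/-- The table of lightest shifted columns is correct where `D` holds. -/
def Table (x : Tri p q → ℚ) (D : ℕ → ℕ → Prop) (s : State) : Prop :=
  ∀ m k, k < q → k ≤ m → D m k → s.ratArr 1 (m * q + k) = lightest (entry x) m k

/-- The registers and the array that the main loop does not change. -/
structure Fixed (x : Tri p q → ℚ) (s : State) : Prop where
  rows : s.reg 0 = p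
  cols : s.reg 1 = q
  one : s.reg 10 = 1
  zero : s.reg 11 = 0
  two : s.reg 12 = 2
  rone : s.acc 4 = 1
  rzero : s.acc 5 = 0
  input : ∀ i j, j < q → s.ratArr 0 (i * q + j) = entry x i j

/-- The memory while the position `(i, j)` is processed. -/
structure Cell (x : Tri p q → ℚ) (i j : ℕ) (s : State) : Prop extends Fixed x s where
  row : s.reg 2 = i
  col : s.reg 3 = j
  base : s.reg 14 = i * q
  addr : s.reg 4 = i * q + j
  next : s.reg 15 = j + 1
  ent : s.acc 0 = entry x i j
  sum : s.acc 1 = ∑ k ∈ Ico j q, entry x i k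
  prev : 1 ≤ j → j ≤ i → s.acc 3 = lightest (entry x) (i - 1) (j - 1)

/-- The memory before the columns to the left of `j` in row `i` are processed. -/
structure RowInv (x : Tri p q → ℚ) (i j : ℕ) (s : State) : Prop extends Fixed x s where
  row : s.reg 2 = i
  col : s.reg 3 = j
  base : s.reg 14 = i * q
  sum : s.acc 1 = ∑ k ∈ Ico j q, entry x i k
  table : Table x (Before i j) s
  found : Recorded x (∀ m k, m < p → k < q → k ≤ m → Before i j m k → CellOK x m k) s

theorem RowInv.load {i j : ℕ} {s : State} (h : RowInv x i (j + 1) s) (hj : j < q) :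
    Cell x i j (loadProg.eval s) ∧ (loadProg.eval s).ratArr = s.ratArr ∧
      (∀ r ∈ ({5, 6, 7, 8} : Set ℕ), (loadProg.eval s).reg r = s.reg r) ∧
      (j < i → (loadProg.eval s).acc 2 = lightest (entry x) (i - 1) j + entry x i j) := by
  have hx := h.input i j hj
  have hup : j < i → s.ratArr 1 (i * q + j - q) = lightest (entry x) (i - 1) j := by
    intro hji
    rw [← h.table (i - 1) j hj (by omega) (Or.inl (by omega)), Nat.sub_one_mul]
    congr 1
    have : q ≤ i * q := Nat.le_mul_of_pos_left q (by omega)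
    omega
  have hdiag : 1 ≤ j → j ≤ i →
      s.ratArr 1 (i * q + j - q - 1) = lightest (entry x) (i - 1) (j - 1) := by
    intro h1 hji
    rw [← h.table (i - 1) (j - 1) (by omega) (by omega) (Or.inl (by omega)), Nat.sub_one_mul]
    congr 1
    have : q ≤ i * q := Nat.le_mul_of_pos_left q (by omega)
    omega
  have e := Prog.eval_block [.natSub 3 3 10, .natAdd 4 14 3, .natAdd 15 3 10, .ratLoad 0 0 4,
    .ratAdd 1 1 0, .natSub 9 4 1, .ratLoad 2 1 9, .ratAdd 2 2 0, .natSub 9 9 10, .ratLoad 3 1 9] s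
  rw [loadProg, e]
  refine ⟨⟨⟨?_, ?_, ?_, ?_, ?_, ?_, ?_, ?_⟩, ?_, ?_, ?_, ?_, ?_, ?_, ?_, ?_⟩, ?_, ?_, ?_⟩
  · simpa [Instr.run] using h.rows
  · simpa [Instr.run] using h.cols
  · simpa [Instr.run] using h.one
  · simpa [Instr.run] using h.zero
  · simpa [Instr.run] using h.two
  · simpa [Instr.run] using h.rone
  · simpa [Instr.run] using h.rzero
  · simpa [Instr.run] using h.input
  · simpa [Instr.run] using h.row
  · simp [Instr.run, h.col, h.one]
  · simpa [Instr.run] using h.base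
  · simp [Instr.run, h.col, h.one, h.base]
  · simp [Instr.run, h.col, h.one]
  · simp [Instr.run, h.col, h.one, h.base, hx]
  · rw [Finset.sum_eq_sum_Ico_succ_bot hj, add_comm (entry x i j)]
    simp [Instr.run, h.col, h.one, h.base, hx, h.sum]
  · intro h1 hji
    simp [Instr.run, h.col, h.one, h.base, h.cols, hdiag h1 hji]
  · simp [Instr.run]
  · rintro r (rfl | rfl | rfl | rfl) <;> simp [Instr.run]
  · intro hji
    simp [Instr.run, h.col, h.one, h.base, h.cols, hup hji, hx]

theorem mul_add_inj {q m k i j : ℕ} (hk : k < q) (hj : j < q) (h : m * q + k = i * q + j) :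
    m = i ∧ k = j := by
  have h1 : (m * q + k) / q = m := by
    rw [mul_comm, Nat.mul_add_div (by omega), Nat.div_eq_of_lt hk, add_zero]
  have h2 : (i * q + j) / q = i := by
    rw [mul_comm, Nat.mul_add_div (by omega), Nat.div_eq_of_lt hj, add_zero]
  have hm : m = i := by rw [← h1, ← h2, h]
  subst hm
  exact ⟨rfl, by omega⟩

/-- Storing a value in register `2` at the current address. -/
theorem Cell.store {i j : ℕ} {s : State} (h : Cell x i j s) (hj : j < q)
    (ht : Table x (Before i (j + 1)) s) {v : ℚ} (hv : v = lightest (entry x) i j) :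
    let s' : State := { s with
      acc := Function.update s.acc 2 v
      ratArr := Function.update s.ratArr 1 (Function.update (s.ratArr 1) (i * q + j) v) }
    Cell x i j s' ∧ Table x (Before i j) s' ∧ s'.reg = s.reg := by
  refine ⟨⟨⟨h.rows, h.cols, h.one, h.zero, h.two, ?_, ?_, ?_⟩, h.row, h.col, h.base, h.addr, h.next,
    ?_, ?_, ?_⟩, ?_, rfl⟩
  · simpa using h.rone
  · simpa using h.rzero
  · simpa using h.input
  · simpa using h.ent
  · simpa using h.sum
  · simpa using h.prev
  · intro m k hk hkm hb
    simp only [Function.update_self]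
    by_cases hmk : m = i ∧ k = j
    · obtain ⟨rfl, rfl⟩ := hmk
      rw [Function.update_self, hv]
    · rw [Function.update_of_ne fun he => hmk (mul_add_inj hk hj he)]
      refine ht m k hk hkm ?_
      unfold Before at hb ⊢
      omega

theorem Cell.table {i j : ℕ} {s : State} (h : Cell x i j s) (hj : j < q) (hji : j ≤ i)
    (hacc : j < i → s.acc 2 = lightest (entry x) (i - 1) j + entry x i j)
    (ht : Table x (Before i (j + 1)) s) :
    Cell x i j (tableProg.eval s) ∧ Table x (Before i j) (tableProg.eval s) ∧
      (tableProg.eval s).reg = s.reg := by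
  have hstore : ∀ (s₁ : State) (v : ℚ), s₁ = { s with acc := Function.update s.acc 2 v } →
      (Instr.ratStore 1 4 2).run s₁ = { s with
        acc := Function.update s.acc 2 v
        ratArr := Function.update s.ratArr 1 (Function.update (s.ratArr 1) (i * q + j) v) } := by
    rintro _ v rfl
    simp [Instr.run, h.addr]
  have hself : s = { s with acc := Function.update s.acc 2 (s.acc 2) } := by
    rw [Function.update_eq_self]
  rcases hji.lt_or_eq with hlt | rfl
  · have hacc := hacc hlt
    rcases Nat.eq_zero_or_pos j with rfl | hpos
    · have e : tableProg.eval s = (Instr.ratStore 1 4 2).run s := by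
        simp [tableProg, Prog.eval, Test.Holds, h.row, h.col, h.zero, hlt, Instr.run]
      rw [e, hstore s _ hself]
      exact h.store hj ht (by rw [hacc, lightest_zero _ hlt])
    · have hprev := h.prev hpos hji
      by_cases hcmp : s.acc 3 < s.acc 2
      · have e : tableProg.eval s = (Instr.ratStore 1 4 2).run
            { s with acc := Function.update s.acc 2 (s.acc 3) } := by
          simp [tableProg, Prog.eval, Test.Holds, h.row, h.col, h.zero, hlt, hpos, hcmp, Instr.run,
            h.rzero]
        rw [e, hstore _ _ rfl]
        refine h.store hj ht ?_
        rw [lightest_eq_min _ hpos hlt, ← hacc, ← hprev, min_eq_right hcmp.le]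
      · have e : tableProg.eval s = (Instr.ratStore 1 4 2).run s := by
          simp [tableProg, Prog.eval, Test.Holds, h.row, h.col, h.zero, hlt, hpos, hcmp, Instr.run]
        rw [e, hstore s _ hself]
        refine h.store hj ht ?_
        rw [lightest_eq_min _ hpos hlt, ← hacc, ← hprev, min_eq_left (not_lt.1 hcmp)]
  · have e : tableProg.eval s = (Instr.ratStore 1 4 2).run
        { s with acc := Function.update s.acc 2 (s.acc 0) } := by
      simp [tableProg, Prog.eval, Test.Holds, h.row, h.col, Instr.run, h.rzero]
    rw [e, hstore _ _ rfl]
    exact h.store hj ht (by rw [h.ent, lightest_diag])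

/-- The effect of recording a violated constraint. -/
theorem Cell.record {i j kind : ℕ} {s : State} (h : Cell x i j s) {D : ℕ → ℕ → Prop}
    (ht : Table x D s) (hv : Violated x kind i j) (A : Prop) :
    Cell x i j ((recordProg kind).eval s) ∧ Table x D ((recordProg kind).eval s) ∧
      Recorded x A ((recordProg kind).eval s) := by
  rw [recordProg, Prog.eval_block]
  refine ⟨⟨⟨?_, ?_, ?_, ?_, ?_, h.rone, h.rzero, h.input⟩, ?_, ?_, ?_, ?_, ?_, h.ent, h.sum,
    h.prev⟩, ht, Or.inr ⟨?_, ?_⟩⟩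
  · simpa [Instr.run] using h.rows
  · simpa [Instr.run] using h.cols
  · simpa [Instr.run] using h.one
  · simpa [Instr.run] using h.zero
  · simpa [Instr.run] using h.two
  · simpa [Instr.run] using h.row
  · simpa [Instr.run] using h.col
  · simpa [Instr.run] using h.base
  · simpa [Instr.run] using h.addr
  · simpa [Instr.run] using h.next
  · simpa [Instr.run, h.row, h.col, h.zero] using hv
  · simp [Instr.run, h.row, h.col, h.zero, h.addr]

theorem Recorded.and {A B : Prop} {s : State} (h : Recorded x A s) (hB : B) :
    Recorded x (A ∧ B) s :=
  h.imp_left fun h => ⟨h.1, h.2, hB⟩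

theorem Cell.sign {i j : ℕ} {s : State} (h : Cell x i j s) (hi : i < p) (hj : j < q) (hji : j ≤ i)
    {D : ℕ → ℕ → Prop} (ht : Table x D s) {A : Prop} (hr : Recorded x A s) :
    Cell x i j (signProg.eval s) ∧ Table x D (signProg.eval s) ∧
      Recorded x (A ∧ (¬ (i = j ∧ j + 1 < q) → 0 ≤ entry x i j)) (signProg.eval s) := by
  by_cases hneg : entry x i j < 0
  · by_cases hd : i = j ∧ j + 1 < q
    · have e : signProg.eval s = s := by
        simp [signProg, Prog.eval, Test.Holds, h.row, h.col, h.ent, h.rzero, h.next, h.cols, hd.1,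
          hd.2, Instr.run]
      rw [e]
      exact ⟨h, ht, hr.and fun h => absurd hd h⟩
    · have e : signProg.eval s = (recordProg 2).eval s := by
        by_cases hlt : j < i
        · simp [signProg, Prog.eval, Test.Holds, h.row, h.col, h.ent, h.rzero, hneg, hlt]
        · have hn : ¬ j + 1 < q := fun h' => hd ⟨by omega, h'⟩
          simp [signProg, Prog.eval, Test.Holds, h.row, h.col, h.ent, h.rzero, hneg, hlt, h.next,
            h.cols, hn]
      rw [e]
      exact h.record ht (Or.inr (Or.inl ⟨rfl, hi, hj, hji, hd, hneg⟩)) _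
  · have e : signProg.eval s = s := by
      simp [signProg, Prog.eval, Test.Holds, h.ent, h.rzero, hneg, Instr.run]
    rw [e]
    exact ⟨h, ht, hr.and fun _ => not_lt.1 hneg⟩

theorem Cell.bar {i j : ℕ} {s : State} (h : Cell x i j s) (hi : i < p) (hj : j < q) (hji : j ≤ i)
    {D : ℕ → ℕ → Prop} (ht : Table x D s) {A : Prop} (hr : Recorded x A s) :
    Cell x i j (barProg.eval s) ∧ Table x D (barProg.eval s) ∧
      Recorded x (A ∧ (j = 0 → ∑ k ∈ Ico j q, entry x i k ≤ 1) ∧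
        (1 ≤ j → ∑ k ∈ Ico j q, entry x i k ≤ lightest (entry x) (i - 1) (j - 1)))
        (barProg.eval s) := by
  rcases Nat.eq_zero_or_pos j with rfl | hpos
  · by_cases hcmp : 1 < ∑ k ∈ Ico 0 q, entry x i k
    · have e : barProg.eval s = (recordProg 1).eval s := by
        simp only [barProg, Prog.eval, Test.Holds, h.col, h.zero, h.rone, h.sum, lt_irrefl, hcmp,
          if_true, if_false]
      rw [e]
      exact h.record ht (Or.inl ⟨rfl, hi, hcmp⟩) _
    · have e : barProg.eval s = s := by
        simp only [barProg, Prog.eval, Test.Holds, h.col, h.zero, h.rone, h.sum, lt_irrefl, hcmp,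
          if_false, Instr.run]
      rw [e]
      exact ⟨h, ht, hr.and ⟨fun _ => not_lt.1 hcmp, fun h => by omega⟩⟩
  · have hprev := h.prev hpos hji
    by_cases hcmp : lightest (entry x) (i - 1) (j - 1) < ∑ k ∈ Ico j q, entry x i k
    · have e : barProg.eval s = (recordProg 3).eval s := by
        simp only [barProg, Prog.eval, Test.Holds, h.col, h.zero, hprev, h.sum, hpos, hcmp, if_true]
      rw [e]
      exact h.record ht (Or.inr (Or.inr ⟨rfl, hi, hj, hpos, hji, hcmp⟩)) _
    · have e : barProg.eval s = s := by
        simp only [barProg, Prog.eval, Test.Holds, h.col, h.zero, hprev, h.sum, hpos, hcmp, if_true,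
          if_false, Instr.run]
      rw [e]
      exact ⟨h, ht, hr.and ⟨fun h => by omega, fun _ => not_lt.1 hcmp⟩⟩

theorem RowInv.cell {i j : ℕ} {s : State} (h : RowInv x i (j + 1) s) (hi : i < p) (hj : j < q) :
    RowInv x i j (cellProg.eval s) := by
  obtain ⟨hc, harr, hreg, hacc⟩ := h.load hj
  have ht : Table x (Before i (j + 1)) (loadProg.eval s) := by
    unfold Table
    rw [harr]
    exact h.table
  have hr : Recorded x (∀ m k, m < p → k < q → k ≤ m → Before i (j + 1) m k → CellOK x m k)
      (loadProg.eval s) := by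
    unfold Recorded
    rw [hreg 5 (by simp), hreg 6 (by simp), hreg 7 (by simp), hreg 8 (by simp)]
    exact h.found
  by_cases hij : i < j
  · have e : cellProg.eval s = loadProg.eval s := by
      simp [cellProg, Prog.eval, Test.Holds, hc.row, hc.col, hij, Instr.run]
    rw [e]
    -- the position lies above the diagonal, where nothing is to be checked
    have hbef : ∀ {m k}, k ≤ m → Before i j m k → Before i (j + 1) m k := by
      intro m k hkm hb
      unfold Before at *
      omega
    exact ⟨hc.toFixed, hc.row, hc.col, hc.base, hc.sum,
      fun m k hk hkm hb => ht m k hk hkm (hbef hkm hb),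
      hr.imp_left fun h => ⟨h.1, fun m k hm hk hkm hb => h.2 m k hm hk hkm (hbef hkm hb)⟩⟩
  · have e : cellProg.eval s = barProg.eval (signProg.eval (tableProg.eval (loadProg.eval s))) := by
      simp [cellProg, Prog.eval, Test.Holds, hc.row, hc.col, hij]
    rw [e]
    have hji : j ≤ i := not_lt.1 hij
    obtain ⟨hc₁, ht₁, hreg₁⟩ := hc.table hj hji hacc ht
    have hr₁ : Recorded x (∀ m k, m < p → k < q → k ≤ m → Before i (j + 1) m k → CellOK x m k)
        (tableProg.eval (loadProg.eval s)) := by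
      unfold Recorded
      rw [hreg₁]
      exact hr
    obtain ⟨hc₂, ht₂, hr₂⟩ := hc₁.sign hi hj hji ht₁ hr₁
    obtain ⟨hc₃, ht₃, hr₃⟩ := hc₂.bar hi hj hji ht₂ hr₂
    refine ⟨hc₃.toFixed, hc₃.row, hc₃.col, hc₃.base, hc₃.sum, ht₃, hr₃.imp_left ?_⟩
    rintro ⟨h0, ⟨hA, hsign⟩, hbar⟩
    refine ⟨h0, fun m k hm hk hkm hb => ?_⟩
    by_cases hmk : m = i ∧ k = j
    · obtain ⟨rfl, rfl⟩ := hmk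
      exact ⟨hsign, hbar⟩
    · refine hA m k hm hk hkm ?_
      unfold Before at hb ⊢
      omega

end


section

variable {p q : ℕ} {x : Tri p q → ℚ}

theorem loopFree_recordProg (kind : ℕ) : (recordProg kind).LoopFree := Prog.loopFree_block _

theorem loopFree_cellProg : cellProg.LoopFree :=
  ⟨Prog.loopFree_block _, trivial, ⟨⟨⟨⟨trivial, trivial⟩, trivial⟩, trivial⟩, trivial⟩,
    ⟨⟨loopFree_recordProg 2, trivial, loopFree_recordProg 2⟩, trivial⟩,
    ⟨loopFree_recordProg 3, trivial⟩, loopFree_recordProg 1, trivial⟩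

theorem loopFree_traceStep : traceStep.LoopFree :=
  ⟨Prog.loopFree_block _, ⟨Prog.loopFree_block _, Prog.loopFree_block _⟩, Prog.loopFree_block _⟩

/-! ### The loops -/

/-- The memory before row `i` is processed. -/
structure RowStart (x : Tri p q → ℚ) (i : ℕ) (s : State) : Prop extends Fixed x s where
  row : s.reg 2 = i
  base : s.reg 14 = i * q
  table : Table x (fun m _ => m < i) s
  found : Recorded x (∀ m k, m < p → k < q → k ≤ m → m < i → CellOK x m k) s

theorem RowStart.runs {i : ℕ} {s : State} (h : RowStart x i s) (hi : i < p) :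
    Runs rowProg s (3 + ((q * (cellProg.size + 1) + 1) + 3)) (RowStart x (i + 1)) := by
  have hinit : RowInv x i q ((Prog.block [.ratConst 1 0, .natAdd 3 1 11]).eval s) := by
    rw [Prog.eval_block]
    refine ⟨⟨?_, ?_, ?_, ?_, ?_, ?_, ?_, h.input⟩, ?_, ?_, ?_, ?_, ?_, ?_⟩
    · simpa [Instr.run] using h.rows
    · simpa [Instr.run] using h.cols
    · simpa [Instr.run] using h.one
    · simpa [Instr.run] using h.zero
    · simpa [Instr.run] using h.two
    · simpa [Instr.run] using h.rone
    · simpa [Instr.run] using h.rzero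
    · simpa [Instr.run] using h.row
    · simp [Instr.run, h.cols, h.zero]
    · simpa [Instr.run] using h.base
    · simp [Instr.run]
    · intro m k hk hkm hb
      refine h.table m k hk hkm ?_
      unfold Before at hb
      omega
    · have hr := h.found
      unfold Recorded at hr ⊢
      simp only [Instr.run, List.foldl_cons, List.foldl_nil]
      refine Or.imp (fun h' => ⟨by simpa using h'.1, fun m k hm hk hkm hb => ?_⟩)
        (fun h' => by simpa using h') hr
      refine h'.2 m k hm hk hkm ?_
      unfold Before at hb
      omega
  refine Runs.seq ((Prog.loopFree_block _).runs hinit) fun s₁ h₁ => ?_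
  refine Runs.seq (Runs.loop (T := cellProg.size) (fun n s => RowInv x i n s ∧ n ≤ q) ?_
    ⟨h₁, le_rfl⟩) fun s₂ h₂ => ?_
  · rintro n s ⟨hn, hnq⟩ hb
    have hpos : 0 < n := by
      have : s.reg 11 < s.reg 3 := hb
      rwa [hn.zero, hn.col] at this
    obtain ⟨n, rfl⟩ : ∃ n', n = n' + 1 := ⟨n - 1, by omega⟩
    exact ⟨n, rfl, loopFree_cellProg.runs ⟨hn.cell hi (by omega), by omega⟩⟩
  · obtain ⟨n, ⟨hn, -⟩, hb⟩ := h₂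
    obtain rfl : n = 0 := by
      have : ¬ s₂.reg 11 < s₂.reg 3 := hb
      rw [hn.zero, hn.col] at this
      omega
    refine (Prog.loopFree_block [.natAdd 14 14 1, .natAdd 2 2 10]).runs ?_
    rw [Prog.eval_block]
    refine ⟨⟨?_, ?_, ?_, ?_, ?_, hn.rone, hn.rzero, hn.input⟩, ?_, ?_, ?_, ?_⟩
    · simpa [Instr.run] using hn.rows
    · simpa [Instr.run] using hn.cols
    · simpa [Instr.run] using hn.one
    · simpa [Instr.run] using hn.zero
    · simpa [Instr.run] using hn.two
    · simp [Instr.run, hn.row, hn.one]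
    · simp [Instr.run, hn.base, hn.cols, Nat.succ_mul]
    · intro m k hk hkm hb
      refine hn.table m k hk hkm ?_
      unfold Before
      omega
    · have hr := hn.found
      unfold Recorded at hr ⊢
      simp only [Instr.run, List.foldl_cons, List.foldl_nil]
      refine Or.imp (fun h' => ⟨by simpa using h'.1, fun m k hm hk hkm hb => ?_⟩)
        (fun h' => by simpa using h') hr
      refine h'.2 m k hm hk hkm ?_
      unfold Before
      omega

/-- The memory while the lightest shifted column for `(K + D, K)` is traced back. -/
structure TraceInv (x : Tri p q → ℚ) (K D k d : ℕ) (s : State) : Prop extends Fixed x s where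
  table : Table x (fun m _ => m < p) s
  col : s.reg 3 = k
  diag : s.reg 16 = d
  addr : s.reg 4 = (k + d) * q + k
  kind : s.reg 5 = 3
  foundRow : s.reg 6 = K + D + 1
  foundCol : s.reg 7 = K + 1
  trace : Trace (entry x) K D (s.natArr 0) k d

theorem TraceInv.step {K D k d : ℕ} {s : State} (h : TraceInv x K D k (d + 1) s) (hK : K < q)
    (hD : K + D < p) : ∃ k' d', k + d = k' + d' ∧ TraceInv x K D k' d' (traceStep.eval s) := by
  have hle := h.trace.le_col
  have hle' := h.trace.le_diag
  have hin := h.input (k + (d + 1)) k (by omega)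
  have haddr : (k + (d + 1)) * q + k - q = (k + d) * q + k := by
    rw [← add_assoc, Nat.succ_mul]
    omega
  have hup := h.table (k + d) k (by omega) (by omega) (by omega)
  set s₁ := (Prog.block [.ratLoad 0 0 4, .natSub 9 4 1, .ratLoad 2 1 9, .ratAdd 2 2 0,
    .natSub 13 9 10, .ratLoad 3 1 13]).eval s with hs₁
  have he₁ := hs₁
  rw [Prog.eval_block] at he₁
  have hreg : ∀ r, r ≠ 9 → r ≠ 13 → s₁.reg r = s.reg r := by
    intro r h1 h2
    simp [he₁, Instr.run, h1, h2]
  have hreg9 : s₁.reg 9 = (k + d) * q + k := by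
    simp [he₁, Instr.run, h.addr, h.cols, haddr]
  have hreg13 : s₁.reg 13 = (k + d) * q + k - 1 := by
    simp [he₁, Instr.run, h.addr, h.cols, haddr, h.one]
  have hacc2 : s₁.acc 2 = lightest (entry x) (k + d) k + entry x (k + (d + 1)) k := by
    simp [he₁, Instr.run, h.addr, h.cols, haddr, hup, hin]
  have hacc3 : s₁.acc 3 = s.ratArr 1 ((k + d) * q + k - 1) := by
    simp [he₁, Instr.run, h.addr, h.cols, haddr, h.one]
  have hacc4 : s₁.acc 4 = 1 := by
    simpa [he₁, Instr.run] using h.rone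
  have hacc5 : s₁.acc 5 = 0 := by
    simpa [he₁, Instr.run] using h.rzero
  have hrat : s₁.ratArr = s.ratArr := by
    simp [he₁, Instr.run]
  have hnat : s₁.natArr = s.natArr := by
    simp [he₁, Instr.run]
  have htable : Table x (fun m _ => m < p) s₁ := by
    unfold Table
    rw [hrat]
    exact h.table
  have hinput : ∀ i j, j < q → s₁.ratArr 0 (i * q + j) = entry x i j := by
    rw [hrat]
    exact h.input
  -- the element in column `k` is taken
  have take : lightest (entry x) (k + (d + 1)) k =
      lightest (entry x) (k + d) k + entry x (k + (d + 1)) k →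
      TraceInv x K D k d
        ((Prog.block [.natStore 0 16 3, .natAdd 4 9 11, .natSub 16 16 10]).eval s₁) := by
    intro he
    rw [Prog.eval_block]
    refine ⟨⟨?_, ?_, ?_, ?_, ?_, hacc4, hacc5, hinput⟩, htable, ?_, ?_, ?_, ?_, ?_, ?_, ?_⟩
    · simpa [Instr.run, hreg] using h.rows
    · simpa [Instr.run, hreg] using h.cols
    · simpa [Instr.run, hreg] using h.one
    · simpa [Instr.run, hreg] using h.zero
    · simpa [Instr.run, hreg] using h.two
    · simpa [Instr.run, hreg] using h.col
    · simp [Instr.run, hreg, h.diag, h.one]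
    · simp [Instr.run, hreg, hreg9, h.zero]
    · simpa [Instr.run, hreg] using h.kind
    · simpa [Instr.run, hreg] using h.foundRow
    · simpa [Instr.run, hreg] using h.foundCol
    · simpa [Instr.run, hreg, hnat, h.diag, h.col] using h.trace.take he
  have hzero : s₁.reg 11 = 0 := (hreg 11 (by omega) (by omega)).trans h.zero
  have hcol : s₁.reg 3 = k := (hreg 3 (by omega) (by omega)).trans h.col
  rcases k with _ | k
  · refine ⟨0, d, rfl, ?_⟩
    have e : traceStep.eval s =
        (Prog.block [.natStore 0 16 3, .natAdd 4 9 11, .natSub 16 16 10]).eval s₁ := by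
      have hb : ¬ (Test.natLT 11 3).Holds s₁ := by simp [Test.Holds, hzero, hcol]
      simp only [traceStep, Prog.eval]
      rw [← hs₁, if_neg hb]
    rw [e]
    exact take (lightest_zero _ (by omega))
  · have hdiag := h.table (k + (d + 1)) k (by omega) (by omega) (by omega)
    have hmul : (k + 1 + d) * q + (k + 1) - 1 = (k + (d + 1)) * q + k := by
      rw [show k + 1 + d = k + (d + 1) by omega]
      omega
    rw [hmul] at hreg13 hacc3
    rw [hdiag] at hacc3
    have hmin := lightest_eq_min (entry x) (i := k + 1 + (d + 1)) (j := k + 1) (by omega)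
      (by omega)
    rw [show k + 1 + (d + 1) - 1 = k + 1 + d by omega, Nat.add_sub_cancel, ← hacc2,
      show k + 1 + d = k + (d + 1) by omega, ← hacc3] at hmin
    have hb : (Test.natLT 11 3).Holds s₁ := by simp [Test.Holds, hzero, hcol]
    by_cases hcmp : s₁.acc 3 < s₁.acc 2
    · refine ⟨k, d + 1, by omega, ?_⟩
      have e : traceStep.eval s = (Prog.block [.natAdd 4 13 11, .natSub 3 3 10]).eval s₁ := by
        simp only [traceStep, Prog.eval]
        rw [← hs₁, if_pos hb, if_pos (show (Test.ratLT 3 2).Holds s₁ from hcmp)]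
      rw [min_eq_right hcmp.le, hacc3] at hmin
      rw [e, Prog.eval_block]
      refine ⟨⟨?_, ?_, ?_, ?_, ?_, hacc4, hacc5, hinput⟩, htable, ?_, ?_, ?_, ?_, ?_, ?_, ?_⟩
      · simpa [Instr.run, hreg] using h.rows
      · simpa [Instr.run, hreg] using h.cols
      · simpa [Instr.run, hreg] using h.one
      · simpa [Instr.run, hreg] using h.zero
      · simpa [Instr.run, hreg] using h.two
      · simp [Instr.run, hreg, h.col, h.one]
      · simpa [Instr.run, hreg] using h.diag
      · simp [Instr.run, hreg, hreg13, h.zero]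
      · simpa [Instr.run, hreg] using h.kind
      · simpa [Instr.run, hreg] using h.foundRow
      · simpa [Instr.run, hreg] using h.foundCol
      · simpa [Instr.run, hnat] using h.trace.skip hmin
    · have e : traceStep.eval s =
          (Prog.block [.natStore 0 16 3, .natAdd 4 9 11, .natSub 16 16 10]).eval s₁ := by
        simp only [traceStep, Prog.eval]
        rw [← hs₁, if_pos hb, if_neg (show ¬ (Test.ratLT 3 2).Holds s₁ from hcmp)]
      refine ⟨k + 1, d, rfl, ?_⟩
      rw [e]
      refine take ?_
      rw [min_eq_left (not_lt.1 hcmp)] at hmin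
      rw [hmin, hacc2]

/-- The memory after a lightest shifted column for `(K + D, K)` has been traced back. -/
def Traced (x : Tri p q → ℚ) (K D : ℕ) (s : State) : Prop :=
  s.reg 11 = 0 ∧ s.reg 5 = 3 ∧ s.reg 6 = K + D + 1 ∧ s.reg 7 = K + 1 ∧
    IsStart (s.natArr 0) D K ∧ lightest (entry x) (K + D) K =
      ∑ t ∈ range (D + 1), entry x (s.natArr 0 t + t) (s.natArr 0 t)

theorem runs_traceProg {s : State} {K D : ℕ} (hf : Fixed x s)
    (ht : Table x (fun m _ => m < p) s) (hkind : s.reg 5 = 3) (hrow : s.reg 6 = K + D + 1)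
    (hcol : s.reg 7 = K + 1) (haddr : s.reg 8 = s.reg 6 * q + s.reg 7) (hK : K < q)
    (hD : K + D < p) :
    Runs traceProg s (5 + (((K + D) * (traceStep.size + 1) + 1) + 1)) (Traced x K D) := by
  have hinit : TraceInv x K D K D
      ((Prog.block [.natSub 3 7 10, .natSub 4 8 1, .natSub 4 4 10, .natSub 16 6 7]).eval s) := by
    rw [Prog.eval_block]
    refine ⟨⟨?_, ?_, ?_, ?_, ?_, hf.rone, hf.rzero, hf.input⟩, ht, ?_, ?_, ?_, ?_, ?_, ?_,
      Trace.start _ K D _⟩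
    · simpa [Instr.run] using hf.rows
    · simpa [Instr.run] using hf.cols
    · simpa [Instr.run] using hf.one
    · simpa [Instr.run] using hf.zero
    · simpa [Instr.run] using hf.two
    · simp [Instr.run, hcol, hf.one]
    · simp [Instr.run, hrow, hcol]
    · simp [Instr.run, haddr, hrow, hcol, hf.cols, hf.one, Nat.succ_mul]
      omega
    · simpa [Instr.run] using hkind
    · simpa [Instr.run] using hrow
    · simpa [Instr.run] using hcol
  refine Runs.seq ((Prog.loopFree_block _).runs hinit) fun s₁ h₁ => ?_
  refine Runs.seq (Runs.loop (T := traceStep.size)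
    (fun n s => ∃ k d, n = k + d ∧ TraceInv x K D k d s) ?_ ⟨K, D, rfl, h₁⟩) fun s₂ h₂ => ?_
  · rintro n s ⟨k, d, rfl, h⟩ hb
    have hpos : 0 < d := by
      have : s.reg 11 < s.reg 16 := hb
      rwa [h.zero, h.diag] at this
    obtain ⟨d, rfl⟩ : ∃ d', d = d' + 1 := ⟨d - 1, by omega⟩
    exact ⟨k + d, rfl, loopFree_traceStep.runs (h.step hK hD)⟩
  · obtain ⟨n, ⟨k, d, -, h⟩, hb⟩ := h₂
    obtain rfl : d = 0 := by
      have : ¬ s₂.reg 11 < s₂.reg 16 := hb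
      rw [h.zero, h.diag] at this
      omega
    have hP : (Prog.instr (.natStore 0 11 3)).LoopFree := trivial
    refine hP.runs ?_
    have harr : ((Prog.instr (.natStore 0 11 3)).eval s₂).natArr 0 =
        Function.update (s₂.natArr 0) 0 k := by
      simp [Prog.eval, Instr.run, h.zero, h.col]
    refine ⟨h.zero, h.kind, h.foundRow, h.foundCol, ?_⟩
    rw [harr]
    exact h.trace.isStart

/-! ### The answer -/

theorem sum_entry_cast {s : Finset ℕ} {i : ℕ} :
    ∑ k ∈ s, entry (fun e => (x e : ℝ)) i k = ((∑ k ∈ s, entry x i k : ℚ) : ℝ) := by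
  rw [Rat.cast_sum]
  exact Finset.sum_congr rfl fun k _ => entry_cast x i k

theorem checks_of_cellOK (h : ∀ i j, i < p → j < q → j ≤ i → CellOK x i j) (hq : 0 < q) :
    Checks p q (entry fun e => (x e : ℝ)) where
  supp i j h := entry_of_not _ h
  row i hi := by
    have := (h i 0 hi hq (Nat.zero_le i)).2.1 rfl
    rw [sum_entry_cast, Finset.range_eq_Ico]
    exact_mod_cast this
  nonneg i j hi hj hji hd := by
    have := (h i j hi hj hji).1 hd
    rw [entry_cast]
    exact_mod_cast this
  bar i j hi hj hji := by
    have := (h (i + 1) (j + 1) hi hj (by omega)).2.2 (by omega)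
    rw [Nat.add_sub_cancel, Nat.add_sub_cancel] at this
    rw [sum_entry_cast, show entry (fun e => (x e : ℝ)) = fun i j => ((entry x i j : ℚ) : ℝ) from
      funext fun i => funext fun j => entry_cast x i j, lightest_cast]
    exact_mod_cast this

theorem Traced.isCorrect {K D : ℕ} {s : State} (h : Traced x K D s) (hD : K + D + 1 < p)
    (hK : K + 1 < q)
    (hv : lightest (entry x) (K + D) K < ∑ k ∈ Ico (K + 1) q, entry x (K + D + 1) k) :
    IsCorrectAnswer (fun e => (x e : ℝ))
      (some (shiftedColumnIneq p q (s.reg 6) (s.reg 7) (s.natArr 0))) := by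
  obtain ⟨-, -, h6, h7, hc, hs⟩ := h
  rw [h6, h7]
  have hd : K + D - K = D := by omega
  refine ⟨Or.inr ⟨_, _, _, IsStart.isReducedShift hD hK (by omega) (by rwa [hd]), rfl⟩, ?_⟩
  rw [shiftedColumnIneq_apply, sum_entry_cast, show K + D + 1 - (K + 1) = D by omega,
    Finset.sum_congr rfl fun t _ => entry_cast x (s.natArr 0 t + t) (s.natArr 0 t), ← Rat.cast_sum,
    ← hs]
  change (0 : ℝ) < _
  rw [sub_pos]
  exact_mod_cast hv

theorem rowStart_init (x : Tri p q → ℚ) :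
    RowStart x 0
      ((Prog.block [.natConst 10 1, .natConst 12 2, .ratConst 4 1]).eval (inputState x)) := by
  rw [Prog.eval_block]
  refine ⟨⟨rfl, rfl, rfl, rfl, rfl, rfl, rfl, ?_⟩, rfl, ?_, fun m k _ _ h => by omega,
    Or.inl ⟨rfl, fun m k _ _ _ h => by omega⟩⟩
  · intro i j hj
    change (inputState x).ratArr 0 (i * q + j) = _
    rw [entry_eq_sum]
    refine Finset.sum_congr rfl fun e _ => ?_
    refine if_congr ⟨fun h => mul_add_inj e.col_lt hj h, ?_⟩ rfl rfl
    rintro ⟨rfl, rfl⟩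
    rfl
  · rw [Nat.zero_mul]
    rfl

theorem answer_eq {s : State} (h0 : s.reg 11 = 0) :
    answer p q ((Prog.block [.natAdd 0 5 11, .natAdd 1 6 11, .natAdd 2 7 11]).eval s) =
      match s.reg 5 with
      | 0 => none
      | 1 => some (rowIneq p q (s.reg 6))
      | 2 => some (nonnegIneq p q (s.reg 6) (s.reg 7))
      | _ => some (shiftedColumnIneq p q (s.reg 6) (s.reg 7) (s.natArr 0)) := by
  rw [Prog.eval_block]
  simp only [answer, Instr.run, List.foldl_cons, List.foldl_nil, Function.update_apply, h0]
  generalize s.reg 5 = n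
  rcases n with _ | _ | _ | n <;> simp

theorem runs_separationProg (hq : 2 ≤ q) (hqp : q ≤ p) (x : Tri p q → ℚ) :
    Runs separationProg (inputState x)
      (4 + ((p * (3 + ((q * (cellProg.size + 1) + 1) + 3) + 1) + 1) +
        ((5 + ((p * (traceStep.size + 1) + 1) + 1) + 1) + 4)))
      fun s => IsCorrectAnswer (fun e => (x e : ℝ)) (answer p q s) := by
  refine Runs.seq ((Prog.loopFree_block _).runs (rowStart_init x)) fun s₁ h₁ => ?_
  refine Runs.seq (Runs.loop (T := 3 + ((q * (cellProg.size + 1) + 1) + 3))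
    (fun n s => ∃ i, i + n = p ∧ RowStart x i s) ?_ ⟨0, Nat.zero_add p, h₁⟩) fun s₂ h₂ => ?_
  · rintro n s ⟨i, hin, h⟩ hb
    have hi : i < p := by
      have : s.reg 2 < s.reg 0 := hb
      rwa [h.row, h.rows] at this
    obtain ⟨n, rfl⟩ : ∃ n', n = n' + 1 := ⟨n - 1, by omega⟩
    exact ⟨n, rfl, (h.runs hi).mono le_rfl fun s' h' => ⟨i + 1, by omega, h'⟩⟩
  · obtain ⟨n, ⟨i, hin, h⟩, hb⟩ := h₂
    obtain rfl : i = p := by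
      have : ¬ s₂.reg 2 < s₂.reg 0 := hb
      rw [h.row, h.rows] at this
      omega
    refine Runs.seq (mid := fun s => s.reg 11 = 0 ∧ IsCorrectAnswer (fun e => (x e : ℝ))
      (match s.reg 5 with
      | 0 => none
      | 1 => some (rowIneq i q (s.reg 6))
      | 2 => some (nonnegIneq i q (s.reg 6) (s.reg 7))
      | _ => some (shiftedColumnIneq i q (s.reg 6) (s.reg 7) (s.natArr 0)))) ?_ fun s₃ h₃ => ?_
    · refine Runs.ite (fun hb => ?_) fun hb => ?_
      · have hkind : 2 < s₂.reg 5 := by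
          have : s₂.reg 12 < s₂.reg 5 := hb
          rwa [h.two] at this
        rcases h.found with ⟨h0, -⟩ | ⟨hv, haddr⟩
        · omega
        rcases hv with ⟨h1, -⟩ | ⟨h1, -⟩ | ⟨h3, hr, hc, hc1, hcr, hlt⟩
        · omega
        · omega
        obtain ⟨K, hK⟩ : ∃ K, s₂.reg 7 = K + 1 := ⟨s₂.reg 7 - 1, by omega⟩
        obtain ⟨D, hD⟩ : ∃ D, s₂.reg 6 = K + D + 1 := ⟨s₂.reg 6 - K - 1, by omega⟩
        rw [hK, hD, Nat.add_sub_cancel, Nat.add_sub_cancel] at hlt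
        refine (runs_traceProg h.toFixed h.table h3 hD hK haddr (by omega) (by omega)).mono ?_
          fun s h => ⟨h.1, ?_⟩
        · have := Nat.mul_le_mul_right (traceStep.size + 1) (show K + D ≤ i by omega)
          omega
        · rw [h.2.1]
          exact h.isCorrect (by omega) (by omega) hlt
      · have hkind : ¬ 2 < s₂.reg 5 := by
          have : ¬ s₂.reg 12 < s₂.reg 5 := hb
          rwa [h.two] at this
        have hP : (Prog.instr .nop).LoopFree := trivial
        refine (hP.runs (post := _) ?_).mono (by rw [Prog.size]; omega) fun _ => id
        refine ⟨h.zero, ?_⟩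
        rw [show (Prog.instr .nop).eval s₂ = s₂ from rfl]
        rcases h.found with ⟨h0, hok⟩ | ⟨hv, -⟩
        · rw [h0]
          exact (checks_of_cellOK (fun m k hm hk hkm => hok m k hm hk hkm hm)
            (by omega)).mem_solutions hqp
        · rcases hv with ⟨h1, hr, hlt⟩ | ⟨h2, hr, hc, hcr, hd, hlt⟩ | ⟨h3, -⟩
          · rw [h1]
            refine ⟨Or.inl (Or.inl ⟨_, hr, rfl⟩), ?_⟩
            rw [rowIneq, sumOver_rowSet, Finset.range_eq_Ico, sum_entry_cast]
            change (1 : ℝ) < _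
            exact_mod_cast hlt
          · rw [h2]
            refine ⟨Or.inl (Or.inr ⟨_, _, hr, hc, hcr, hd, rfl⟩), ?_⟩
            rw [nonnegIneq, LinearMap.neg_apply, sumOver_position, entry_cast]
            change (0 : ℝ) < _
            rw [neg_pos]
            exact_mod_cast hlt
          · omega
    · refine (Prog.loopFree_block [.natAdd 0 5 11, .natAdd 1 6 11, .natAdd 2 7 11]).runs ?_
      rw [answer_eq h₃.1]
      exact h₃.2

theorem size_cellProg : cellProg.size ≤ 100 := by decide

theorem size_traceStep : traceStep.size ≤ 100 := by decide

end

end Orbitope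

theorem mainTheorem2 :
    (∀ p q : ℕ, 2 ≤ q → q ≤ p →
      (∀ A ∈ Orbitope.packingOrbitope p q ⊤, ∀ (i : Fin p) (j : Fin q), (i : ℕ) < (j : ℕ) → A i j = 0) ∧
      Orbitope.symPackingOrbitope p q = Orbitope.solutions (Orbitope.packingSystem p q) ∧
      Orbitope.polyDim (Orbitope.symPackingOrbitope p q) = Fintype.card (Orbitope.Tri p q) ∧
      (∀ r ∈ Orbitope.packingSystem p q,
        Orbitope.DefinesFacet (Orbitope.symPackingOrbitope p q) r) ∧
      Orbitope.NonRedundant (Orbitope.packingSystem p q)) ∧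
    ∃ (P : Orbitope.Prog) (C : ℕ), ∀ p q : ℕ, 2 ≤ q → q ≤ p → ∀ x : Orbitope.Tri p q → ℚ,
      ∃ (s : Orbitope.State) (t : ℕ), Orbitope.Exec P (Orbitope.inputState x) s t ∧
        t ≤ C * (p * q) ∧
        Orbitope.IsCorrectAnswer (fun e => (x e : ℝ)) (Orbitope.answer p q s) := by
  refine ⟨fun p q hq hqp => ⟨fun A hA i j hij => Orbitope.packingOrbitope_upper hA hij,
    Orbitope.symPackingOrbitope_eq_solutions hqp, Orbitope.polyDim_symPackingOrbitope p q,
    fun r hr => Orbitope.definesFacet_of_mem (by omega) hr,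
    Orbitope.nonRedundant_packingSystem (by omega) hqp⟩, Orbitope.separationProg, 300,
    fun p q hq hqp x => ?_⟩
  obtain ⟨s, t, e, ht, hs⟩ := Orbitope.runs_separationProg hq hqp x
  refine ⟨s, t, e, ht.trans ?_, hs⟩
  have h₁ := Orbitope.size_cellProg
  have h₂ := Orbitope.size_traceStep
  have hpq : 2 * p ≤ p * q := by
    rw [mul_comm p q]
    exact Nat.mul_le_mul_right p hq
  have h₃ : p * (3 + ((q * (Orbitope.cellProg.size + 1) + 1) + 3) + 1) ≤ 101 * (p * q) + 8 * p := by
    calc _ ≤ p * (3 + ((q * (100 + 1) + 1) + 3) + 1) := by gcongr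
      _ = _ := by ring
  have h₄ : p * (Orbitope.traceStep.size + 1) ≤ 101 * p := by
    rw [mul_comm p]
    gcongr
    omega
  omega
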